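/- Let $R$ be a commutative ring with unit, $D$ an oriented link diagram (in the plane), and number $m\ge 0$ chosen crossings of $D$ by $1,\dots,m$. Let $C^{i,j}(D)=C^{i,j}(D;R)$ be the Khovanov complex over $R$ (homological degree $i$, quantum degree $j$), normalised by $C^{i,j}(D)=\overline C^{\,i+n^-,\,j-n^++2n^-}(D)$, where $n^\pm$ are the numbers of positive and negative crossings of $D$ and $\overline C^{i,*}(D)=\bigoplus_{r_\alpha=i}V^{\otimes k_\alpha}\{r_\alpha\}$ is the unnormalised cube complex, and let $Kh^{i,j}(D;R)$ be its cohomology. For $0\le k\le m$ let $D^k$ be obtained from $D$ by resolving crossings $1,\dots,k$ to $1$-smoothings, so that $D^0=D$. For $1\le k\le m$ let $\widetilde D^k$ be obtained from $D$ by resolving crossings $1,\dots,k-1$ to $1$-smoothings and crossing $k$ to a $0$-smoothing. Orient these diagrams inductively, starting from the orientation of $D^0=D$: if crossing $k$ is positive in $D^{k-1}$, then $\widetilde D^k$ inherits the orientation of $D^{k-1}$ and $D^k$ is oriented arbitrarily; if it is negative, then $D^k$ inherits the orientation of $D^{k-1}$ and $\widetilde D^k$ is oriented arbitrarily. Let $n_k^-$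 and $\widetilde n_k^-$ be the numbers of negative crossings of $D^k$ and $\widetilde D^k$. If crossing $k$ is positive in $D^{k-1}$, put $a_k=n_{k-1}^--n_k^--1$ and $\widetilde a_k=0$; if it is negative, put $a_k=0$ and $\widetilde a_k=n_{k-1}^--\widetilde n_k^-$. Let $b_k=3a_k+1$, $\widetilde b_k=3\widetilde a_k-1$, $A_k=\sum_{i=1}^k a_i$, $B_k=\sum_{i=1}^k b_i$. Fix $j\in\mathbb Z$. For $s\in\mathbb Z$ with $s\le m$ let $F^s\subseteq C^{*,j}(D)$ be the submodule spanned by the summands of those smoothings in which the crossings with number at most $s$ are $1$-smoothed, and let $F^s=0$ for $s>m$. Then $C^{*,j}(D)$ is a cochain complex and $(F^s)_s$ is a decreasing filtration of it by subcomplexes, bounded by $F^s=C^{*,j}(D)$ for $s\le 0$ and $F^s=0$ for $s>m$. There are isomorphisms of complexes $$F^k\cong C^{*+A_k,\;j+B_k}(D^k)\quad(0\le k\le m),\qquad F^{k}/F^{k+1}\cong C^{*+A_k+\widetilde a_{k+1},\;j+B_k+\widetilde b_{k+1}}(\widetilde D^{k+1})\quad(0\le k<m).$$ The spectral sequence of this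 filtered complex, $(E_r^{*,*},\ d_r\colon E_r^{s,t}\to E_r^{s+r,t-r+1})_{r\ge1}$, with terms $$E_r^{s,t}=Z_r^{s}/(Z_{r-1}^{s+1}+dZ_{r-1}^{s-r+1})\ \text{in total degree } s+t,\qquad Z_r^s=\{x\in F^s\mid dx\in F^{s+r}\},$$ and differentials induced by $d$, converges to $Kh^{*,j}(D;R)$: for all $s,t$, the differentials from and to $E_r^{s,t}$ vanish for large $r$ and then $E_r^{s,t}\cong \mathrm{Fil}^sKh^{s+t,j}(D;R)/\mathrm{Fil}^{s+1}Kh^{s+t,j}(D;R)$, where $\mathrm{Fil}^s$ is the finite filtration by the images of the cohomology of $F^s$. Its $E_1$-page is given by $$E_1^{s,t}\cong\begin{cases}Kh^{\,s+t+A_s+\widetilde a_{s+1},\;j+B_s+\widetilde b_{s+1}}(\widetilde D^{s+1};R)& s=0,\dots,m-1,\\ Kh^{\,m+t+A_m,\;j+B_m}(D^m;R)& s=m,\\ 0& s<0\text{ or }s>m.\end{cases}$$ -/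

import Mathlib

open CategoryTheory

universe u

noncomputable section

/-! ### Link diagrams -/

/-- The counterclockwise rotation of the four half-edges at each of `n` four-valent vertices. -/
def rotateDart (n : ℕ) : Equiv.Perm (Fin n × Fin 4) :=
  Equiv.prodCongr (Equiv.refl _) (Equiv.addRight 1)

/-- A plane four-valent graph (possibly disconnected, possibly with closed curves without vertices),
given as a combinatorial map. The half-edges at the vertex `v` are `(v, 0), …, (v, 3)` in
counterclockwise order and `edge` sends a half-edge to the other half of its edge. The orbits of
`rotateDart n * edge` are the boundary walks of faces. As the number of edges is `2 n`, planarity is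
Euler's formula `V - E + F = 2 C` in the form `F = n + 2 C`, where `C` is the number
of connected components that contain a vertex. -/
structure PlaneGraph where
  n : ℕ
  loops : ℕ
  edge : Equiv.Perm (Fin n × Fin 4)
  edge_edge : ∀ x, edge (edge x) = x
  edge_ne : ∀ x, edge x ≠ x
  planar : Nat.card (Quotient (Equiv.Perm.SameCycle.setoid (rotateDart n * edge))) =
    n + 2 * Nat.card (MulAction.orbitRel.Quotient
      (Subgroup.closure ({rotateDart n, edge} : Set (Equiv.Perm (Fin n × Fin 4)))) (Fin n × Fin 4))

namespace PlaneGraph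

abbrev Vertex (G : PlaneGraph) : Type := Fin G.n

/-- Half-edges. -/
abbrev Dart (G : PlaneGraph) : Type := Fin G.n × Fin 4

/-- The pieces of curve from which all smoothings are assembled:
half-edges, and closed curves without vertices. -/
abbrev Piece (G : PlaneGraph) : Type := G.Dart ⊕ Fin G.loops

end PlaneGraph

/-- A vertex of a diagram is a crossing, or a crossing that has been resolved to
its `0`-smoothing (`false`) or its `1`-smoothing (`true`). -/
inductive VertexType : Type
  | crossing : VertexType
  | smoothed (b : Bool) : VertexType

/-- At a crossing the half-edges `0, 2` form the lower strand and `1, 3` the upper strand.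
With the half-edges in counterclockwise order, the `0`-smoothing joins `0` to `1` and `2` to `3`,
and the `1`-smoothing joins `1` to `2` and `3` to `0`. -/
def smoothingPartner (b : Bool) : Fin 4 → Fin 4 :=
  if b then ![3, 2, 1, 0] else ![1, 0, 3, 2]

/-- The half-edge along which a strand that arrives at the vertex along `i` leaves it. -/
def VertexType.partner : VertexType → Fin 4 → Fin 4
  | crossing, i => i + 2
  | smoothed b, i => smoothingPartner b i

/-- A link diagram drawn on `G`: each vertex is a crossing or a resolved crossing. The choice of
the half-edge with number `0` at a crossing says which strand is the lower one. -/
structure LinkDiagram (G : PlaneGraph) where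
  vertexType : G.Vertex → VertexType

namespace LinkDiagram

variable {G : PlaneGraph}

def IsCrossing (D : LinkDiagram G) (v : G.Vertex) : Prop :=
  D.vertexType v = VertexType.crossing

/-- The diagram obtained from `D` by resolving the vertex `v` to the smoothing `b`. -/
def resolve (D : LinkDiagram G) (v : G.Vertex) (b : Bool) : LinkDiagram G where
  vertexType := Function.update D.vertexType v (VertexType.smoothed b)

/-- An orientation: `dir x = true` means that the strand runs along the half-edge `x` away from
its vertex. Orientations run through every edge, crossing and smoothing consistently. -/
structure Orientation (D : LinkDiagram G) where
  dir : G.Piece → Bool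
  dir_edge : ∀ x : G.Dart, dir (Sum.inl (G.edge x)) = !dir (Sum.inl x)
  dir_vertex : ∀ (v : G.Vertex) (i : Fin 4),
    dir (Sum.inl (v, (D.vertexType v).partner i)) = !dir (Sum.inl (v, i))

namespace Orientation

variable {D : LinkDiagram G}

/-- A crossing is positive if the upper strand has to be turned counterclockwise to get to
the direction of the lower strand: if the lower strand runs from `0` to `2`,
the upper strand runs from `3` to `1`. -/
def IsPositive (o : D.Orientation) (v : G.Vertex) : Prop :=
  D.IsCrossing v ∧ o.dir (Sum.inl (v, 0)) = o.dir (Sum.inl (v, 3))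

def IsNegative (o : D.Orientation) (v : G.Vertex) : Prop :=
  D.IsCrossing v ∧ o.dir (Sum.inl (v, 0)) ≠ o.dir (Sum.inl (v, 3))

/-- The number of positive crossings. -/
def nPos (o : D.Orientation) : ℤ := Nat.card {v : G.Vertex // o.IsPositive v}

/-- The number of negative crossings. -/
def nNeg (o : D.Orientation) : ℤ := Nat.card {v : G.Vertex // o.IsNegative v}

end Orientation

end LinkDiagram

/-! ### The Khovanov complex -/

namespace PlaneGraph

variable (G : PlaneGraph)

/-- Pieces that are joined, by an edge or at a vertex, in the smoothing `α` of all vertices. -/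
inductive Joined (α : G.Vertex → Bool) : G.Piece → G.Piece → Prop
  | edge (x : G.Dart) : Joined α (Sum.inl x) (Sum.inl (G.edge x))
  | vertex (v : G.Vertex) (i : Fin 4) :
      Joined α (Sum.inl (v, i)) (Sum.inl (v, smoothingPartner (α v) i))

/-- The circles of the smoothing `α`. -/
def Circle (α : G.Vertex → Bool) : Type := Quot (G.Joined α)

/-- The circle through a piece. -/
def circle (α : G.Vertex → Bool) (p : G.Piece) : G.Circle α := Quot.mk _ p

instance (α : G.Vertex → Bool) : Finite (G.Circle α) :=
  Finite.of_surjective (G.circle α) Quot.mk_surjective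

instance (α : G.Vertex → Bool) : Fintype (G.Circle α) := Fintype.ofFinite _

end PlaneGraph

/-- The basis `1, x` of the Frobenius algebra `V`. -/
inductive Gen : Type
  | one : Gen
  | x : Gen

namespace Gen

instance : Finite Gen :=
  Finite.of_surjective (fun b : Bool => if b then Gen.one else Gen.x)
    (by rintro (_ | _); exacts [⟨true, rfl⟩, ⟨false, rfl⟩])

/-- The degrees of `1` and `x`. -/
def deg : Gen → ℤ
  | one => 1
  | x => -1

/-- `mul a b c` is the coefficient of `c` in the product `a b`, where `x ^ 2 = 0`. -/
def mul : Gen → Gen → Gen → ℤ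
  | one, one, one => 1
  | one, x, x => 1
  | x, one, x => 1
  | _, _, _ => 0

/-- `comul a b c` is the coefficient of `b ⊗ c` in the coproduct of `a`, where
`Δ 1 = 1 ⊗ x + x ⊗ 1` and `Δ x = x ⊗ x`. -/
def comul : Gen → Gen → Gen → ℤ
  | one, one, x => 1
  | one, x, one => 1
  | x, x, x => 1
  | _, _, _ => 0

end Gen

/-- The standard basis elements of the modules `V_α = V^{⊗ k_α}`: a smoothing `α` of all crossings
(with the prescribed smoothings at the resolved vertices), and a basis element of `V`
for each circle. -/
structure EnhancedState {G : PlaneGraph} (D : LinkDiagram G) where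
  α : G.Vertex → Bool
  compat : ∀ v b, D.vertexType v = VertexType.smoothed b → α v = b
  label : G.Circle α → Gen

namespace EnhancedState

variable {G : PlaneGraph} {D : LinkDiagram G}

instance : Finite (EnhancedState D) :=
  Finite.of_injective
    (fun S => (⟨S.α, S.label⟩ : Σ α : G.Vertex → Bool, (G.Circle α → Gen)))
    (by rintro ⟨α, h, l⟩ ⟨α', h', l'⟩ e; cases e; rfl)

/-- The label of the circle through a piece. -/
def labelAt (S : EnhancedState D) (p : G.Piece) : Gen := S.label (G.circle S.α p)

/-- The number `r_α` of crossings that are resolved to `1`. -/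
def height (S : EnhancedState D) : ℤ :=
  Nat.card {v : G.Vertex // D.IsCrossing v ∧ S.α v = true}

/-- The degree in `V^{⊗ k_α}{r_α}`. -/
def qdeg (S : EnhancedState D) : ℤ := (∑ C, (S.label C).deg) + S.height

/-- The sign of the edge of the cube at `α` in the direction `v`. -/
def edgeSign (S : EnhancedState D) (v : G.Vertex) : ℤ :=
  (-1) ^ Nat.card {w : G.Vertex // w < v ∧ D.IsCrossing w ∧ S.α w = true}

open Classical in
/-- The matrix entry, up to sign, at `(S, T)` of the map of the edge of the cube at which the
crossing `v` changes from its `0`- to its `1`-smoothing, for `S`, `T` over the ends of that edge: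
two circles are merged by the product, or a circle is split by the coproduct, and the
labels of the circles that do not pass by `v` are kept. -/
def localCoeff (v : G.Vertex) (S T : EnhancedState D) : ℤ :=
  if ∀ p : G.Piece, G.circle S.α p ≠ G.circle S.α (Sum.inl (v, 0)) →
      G.circle S.α p ≠ G.circle S.α (Sum.inl (v, 2)) → S.labelAt p = T.labelAt p then
    if G.circle S.α (Sum.inl (v, 0)) ≠ G.circle S.α (Sum.inl (v, 2)) then
      Gen.mul (S.labelAt (Sum.inl (v, 0))) (S.labelAt (Sum.inl (v, 2)))
        (T.labelAt (Sum.inl (v, 0)))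
    else if G.circle T.α (Sum.inl (v, 0)) ≠ G.circle T.α (Sum.inl (v, 2)) then
      Gen.comul (S.labelAt (Sum.inl (v, 0))) (T.labelAt (Sum.inl (v, 0)))
        (T.labelAt (Sum.inl (v, 2)))
    else 0
  else 0

open Classical in
/-- The coefficient of `T` in the differential of `S`. -/
def coeff (S T : EnhancedState D) : ℤ :=
  ∑ v : G.Vertex,
    if D.IsCrossing v ∧ S.α v = false ∧ T.α = Function.update S.α v true then
      S.edgeSign v * localCoeff v S T
    else 0

end EnhancedState

/-- The basis of the bidegree `(i, j)` part of the unnormalised complex. -/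
abbrev StateIn {G : PlaneGraph} (D : LinkDiagram G) (i j : ℤ) : Type :=
  {S : EnhancedState D // S.height = i ∧ S.qdeg = j}

instance {G : PlaneGraph} (D : LinkDiagram G) (i j : ℤ) : Fintype (StateIn D i j) :=
  Fintype.ofFinite _

/-- The unnormalised Khovanov complex, in bidegree `(i, j)`. -/
abbrev UnnormalisedKh (R : Type u) {G : PlaneGraph} (D : LinkDiagram G) (i j : ℤ) :
    Type u :=
  StateIn D i j → R

/-- The component from degree `i` to degree `i'` of the differential. It is `0` unless
`i' = i + 1`. -/
def unnormalisedD (R : Type u) [CommRing R] {G : PlaneGraph} (D : LinkDiagram G) (j i i' : ℤ) :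
    UnnormalisedKh R D i j →ₗ[R] UnnormalisedKh R D i' j :=
  Matrix.mulVecLin
    (Matrix.of fun (T : StateIn D i' j) (S : StateIn D i j) => ((S.1.coeff T.1 : ℤ) : R))

/-- The normalised Khovanov complex: the unnormalised one shifted by `[-n⁻]{n⁺ - 2 n⁻}`. -/
abbrev KhComplex (R : Type u) {G : PlaneGraph} {D : LinkDiagram G} (o : D.Orientation)
    (j i : ℤ) : Type u :=
  UnnormalisedKh R D (i + o.nNeg) (j - (o.nPos - 2 * o.nNeg))

/-- The components of the differential of the normalised Khovanov complex. -/
abbrev khD (R : Type u) [CommRing R] {G : PlaneGraph} {D : LinkDiagram G} (o : D.Orientation)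
    (j i i' : ℤ) : KhComplex R o j i →ₗ[R] KhComplex R o j i' :=
  unnormalisedD R D (j - (o.nPos - 2 * o.nNeg)) (i + o.nNeg) (i' + o.nNeg)

/-! ### Cohomology, filtrations and spectral sequences -/

section Filtered

variable {R : Type u} [CommRing R] {C : ℤ → Type u} [∀ n, AddCommGroup (C n)]
  [∀ n, Module R (C n)]

/-- The cohomology in degree `n` of a cochain complex, whose differential is given by its components
`C n → C n'` (only those with `n' = n + 1` matter). -/
abbrev Cohomology (d : ∀ n n' : ℤ, C n →ₗ[R] C n') (n : ℤ) : Type u :=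
  LinearMap.ker (d n (n + 1)) ⧸
    (LinearMap.range (d (n - 1) n)).submoduleOf (LinearMap.ker (d n (n + 1)))

/-- The filtration of the cohomology that is induced by the filtration `F`: its `s`-th term consists
of the classes of the cocycles in `F s`, and is the image of the cohomology of `F s`. -/
def inducedFiltration (d : ∀ n n' : ℤ, C n →ₗ[R] C n') (F : ℤ → ∀ n, Submodule R (C n))
    (n s : ℤ) : Submodule R (Cohomology d n) :=
  ((F s n).submoduleOf (LinearMap.ker (d n (n + 1)))).map (Submodule.mkQ _)

/-- `Z_r^s = {x ∈ F^s C^n | d x ∈ F^{s + r} C^{n + 1}}`. -/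
def approxCycles (d : ∀ n n' : ℤ, C n →ₗ[R] C n') (F : ℤ → ∀ n, Submodule R (C n))
    (r s n : ℤ) : Submodule R (C n) :=
  F s n ⊓ (F (s + r) (n + 1)).comap (d n (n + 1))

/-- `Z_{r-1}^{s+1} + d Z_{r-1}^{s-r+1}`, in degree `n`. -/
def approxBoundaries (d : ∀ n n' : ℤ, C n →ₗ[R] C n') (F : ℤ → ∀ n, Submodule R (C n))
    (r s n : ℤ) : Submodule R (C n) :=
  approxCycles d F (r - 1) (s + 1) n ⊔
    (approxCycles d F (r - 1) (s - r + 1) (n - 1)).map (d (n - 1) n)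

/-- The term of total degree `n` in the column `s` of the page `r` of the spectral sequence of a
filtered complex. -/
abbrev FilteredPage (d : ∀ n n' : ℤ, C n →ₗ[R] C n') (F : ℤ → ∀ n, Submodule R (C n))
    (r s n : ℤ) : Type u :=
  approxCycles d F r s n ⧸
    (approxBoundaries d F r s n).submoduleOf (approxCycles d F r s n)

/-- An identification of `E` (from its page `1` on) with the spectral sequence of the filtered complex
`(C, d, F)`: isomorphisms of all terms with the standard subquotients, which turn
the differentials of the pages into the maps induced by `d`, and the isomorphisms between the
cohomology of a page and the next page into the ones given by the identity on representatives. -/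
structure FilteredComplexIso (d : ∀ n n' : ℤ, C n →ₗ[R] C n')
    (F : ℤ → ∀ n, Submodule R (C n))
    (E : CohomologicalSpectralSequence (ModuleCat.{u} R) 1) where
  e : ∀ (r : ℤ) (hr : 1 ≤ r) (s t : ℤ),
    ((E.page r hr).X (s, t) : Type u) ≃ₗ[R] FilteredPage d F r s (s + t)
  e_d : ∀ (r : ℤ) (hr : 1 ≤ r) (s t : ℤ) (y : (E.page r hr).X (s, t))
    (z : approxCycles d F r s (s + t))
    (w : approxCycles d F r (s + r) ((s + r) + (t - r + 1))),
    w.1 = d _ _ z.1 → e r hr s t y = Submodule.Quotient.mk z →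
      e r hr (s + r) (t - r + 1) (((E.page r hr).d (s, t) (s + r, t - r + 1)).hom y) =
        Submodule.Quotient.mk w
  e_iso : ∀ (r : ℤ) (hr : 1 ≤ r) (s t : ℤ) (y : (E.page r hr).cycles (s, t))
    (z : approxCycles d F r s (s + t)) (w : approxCycles d F (r + 1) s (s + t)),
    w.1 = z.1 → e r hr s t (((E.page r hr).iCycles (s, t)).hom y) = Submodule.Quotient.mk z →
      e (r + 1) (by lia) s t
          ((E.iso r (r + 1) (s, t) rfl hr).hom.hom (((E.page r hr).homologyπ (s, t)).hom y)) =
        Submodule.Quotient.mk w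

/-- Convergence of a spectral sequence to `H`, filtered by `Fil`: the filtration is decreasing and
finite in each degree, and for each `(s, t)` the differentials from and to `E_r^{s,t}` vanish for all
large `r`, and `E_r^{s,t}` (which is then `E_∞^{s,t}`) is isomorphic
to `Fil^s H^{s+t} / Fil^{s+1} H^{s+t}`. -/
structure ConvergesTo (E : CohomologicalSpectralSequence (ModuleCat.{u} R) 1)
    (H : ℤ → Type u) [∀ n, AddCommGroup (H n)] [∀ n, Module R (H n)]
    (Fil : ∀ n : ℤ, ℤ → Submodule R (H n)) : Prop where
  antitone : ∀ n, Antitone (Fil n)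
  exists_eq_top : ∀ n, ∃ s, Fil n s = ⊤
  exists_eq_bot : ∀ n, ∃ s, Fil n s = ⊥
  limit : ∀ s t : ℤ, ∃ r₀ : ℤ, ∀ (r : ℤ) (hr : 1 ≤ r), r₀ ≤ r →
    (∀ q, (E.page r hr).d (s, t) q = 0) ∧ (∀ q, (E.page r hr).d q (s, t) = 0) ∧
      Nonempty (((E.page r hr).X (s, t) : Type u) ≃ₗ[R]
        (Fil (s + t) s ⧸ (Fil (s + t) (s + 1)).submoduleOf (Fil (s + t) s)))

end Filtered

/-- The Khovanov homology in homological degree `i` and quantum degree `j`. -/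
abbrev Kh (R : Type u) [CommRing R] {G : PlaneGraph} {D : LinkDiagram G} (o : D.Orientation)
    (i j : ℤ) : Type u :=
  Cohomology (khD R o j) i

/-! ### The diagrams obtained by successively resolving chosen crossings

The chosen crossings `1, …, m` are `c 0, …, c (m - 1)`. -/

namespace LinkDiagram

variable {G : PlaneGraph} {m : ℕ}

open Classical in
/-- The diagram `D^k`, with the crossings `1, …, k` resolved to `1`-smoothings. -/
def oneResolved (D : LinkDiagram G) (c : Fin m → G.Vertex) (k : ℕ) : LinkDiagram G where
  vertexType v :=
    if ∃ i : Fin m, (i : ℕ) < k ∧ c i = v then VertexType.smoothed true else D.vertexType v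

/-- The diagram `D̃^{i+1}`, with the crossings `1, …, i` resolved to `1`-smoothings and the crossing
`i + 1` resolved to a `0`-smoothing. -/
def zeroResolved (D : LinkDiagram G) (c : Fin m → G.Vertex) (i : Fin m) : LinkDiagram G :=
  (D.oneResolved c i).resolve (c i) false

/-- Orientations of the diagrams `D^k` and `D̃^k`. Start from the orientation `o` of `D = D^0`.
If the crossing `k` is positive in `D^{k-1}`, then `D̃^k` inherits the orientation of `D^{k-1}` and
that of `D^k` is arbitrary; if it is negative, then `D^k` inherits the orientation of `D^{k-1}` and that
of `D̃^k` is arbitrary. -/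
structure ResolvedOrientations (D : LinkDiagram G) (o : D.Orientation)
    (c : Fin m → G.Vertex) where
  one : ∀ k : ℕ, (D.oneResolved c k).Orientation
  zero : ∀ i : Fin m, (D.zeroResolved c i).Orientation
  one_zero : (one 0).dir = o.dir
  of_positive : ∀ i : Fin m, (one i).IsPositive (c i) → (zero i).dir = (one i).dir
  of_negative : ∀ i : Fin m, (one i).IsNegative (c i) → (one (i + 1)).dir = (one i).dir

namespace ResolvedOrientations

variable {D : LinkDiagram G} {o : D.Orientation} {c : Fin m → G.Vertex}

open Classical in
/-- The constant `a_{i+1}`. -/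
def a (O : D.ResolvedOrientations o c) (i : Fin m) : ℤ :=
  if (O.one i).IsPositive (c i) then (O.one i).nNeg - (O.one (i + 1)).nNeg - 1 else 0

open Classical in
/-- The constant `ã_{i+1}`. -/
def aTilde (O : D.ResolvedOrientations o c) (i : Fin m) : ℤ :=
  if (O.one i).IsPositive (c i) then 0 else (O.one i).nNeg - (O.zero i).nNeg

/-- The constant `b_{i+1}`. -/
def b (O : D.ResolvedOrientations o c) (i : Fin m) : ℤ := 3 * O.a i + 1

/-- The constant `b̃_{i+1}`. -/
def bTilde (O : D.ResolvedOrientations o c) (i : Fin m) : ℤ := 3 * O.aTilde i - 1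

/-- `A_k = a_1 + ⋯ + a_k`. -/
def A (O : D.ResolvedOrientations o c) (k : ℕ) : ℤ :=
  ∑ i ∈ Finset.univ.filter (fun i : Fin m => i.val < k), O.a i

/-- `B_k = b_1 + ⋯ + b_k`. -/
def B (O : D.ResolvedOrientations o c) (k : ℕ) : ℤ :=
  ∑ i ∈ Finset.univ.filter (fun i : Fin m => i.val < k), O.b i

end ResolvedOrientations

end LinkDiagram

/-- The filtration of the Khovanov complex of `D` in quantum degree `j`: for `s ≤ m`, the submodule
`F^s` is spanned by the basis elements over the smoothings in which the crossings `1, …, s` are resolved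
to `1`, and `F^s = 0` for `s > m`. -/
def skeinFiltration (R : Type u) [CommRing R] {G : PlaneGraph} {D : LinkDiagram G}
    (o : D.Orientation) {m : ℕ} (c : Fin m → G.Vertex) (j s n : ℤ) :
    Submodule R (KhComplex R o j n) where
  carrier := {f | ∀ S, f S ≠ 0 → s ≤ m ∧ ∀ i : Fin m, (i : ℤ) < s → S.1.α (c i) = true}
  zero_mem' := fun S h => absurd rfl h
  add_mem' := by
    intro f g hf hg S h
    by_cases h0 : f S = 0
    · refine hg S fun h1 => h ?_
      simp [h0, h1]
    · exact hf S h0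
  smul_mem' := by
    intro r f hf S h
    refine hf S fun h1 => h ?_
    simp [h1]

end

/-!
The spectral sequence is that of a filtered complex, so the theorem splits into a general
statement about filtered modules and statements about the Khovanov complex.

For a complex with a decreasing filtration, the terms `Z_r / (Z_{r-1} + d Z_{r-1})` with the maps
induced by `d` are complexes, and the elements of `Z_{r+1}^s` represent all cycles of the page
`r`; they represent boundaries exactly if they lie in `Z_r^{s+1} + d Z_r^{s-r}`. So the homology
of a page is the next page (`IsFilteredComplex.pageIso`). If the filtration is bounded, then
`Z_r^s` consists of cocycles for large `r`, which gives the convergence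
(`IsFilteredComplex.convergesTo`). If `F^s` maps onto a complex `C'` with the kernel `F^{s+1}`,
then the column `s` of the first page is the cohomology of `C'`
(`IsFilteredComplex.nonempty_firstPage_equiv`).

That the Khovanov complex is a complex depends on planarity: the differential is set to zero along
edges of the cube that turn one circle into one circle, and these have to be excluded. Euler's
formula, in the form of a dimension count over `ZMod 2`, shows that the faces of a plane
four-valent graph have a checkerboard colouring, that is, the edges have an orientation that
alternates around each vertex (`PlaneGraph.exists_alternating`). This orientation runs along the
circles of every smoothing, which become the cycles of a permutation of the outgoing half-edges. A
change of the smoothing at a vertex multiplies the permutation by a transposition, hence merges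
two cycles or splits one (`PlaneGraph.merges_or_merges`).

The square of the differential is computed in `V_α = ℤ[x_C] / (x_C ^ 2)`, where `C` runs through
the circles, as a quotient of the polynomial ring in the pieces of curve. There a merger is
induced by the identity of the polynomial ring and a split by the multiplication by the sum of the
two new variables (`EnhancedState.localCoeff_eq_labelCoeff`). So the commutativity of a square of
the cube becomes a congruence between two products of such factors
(`PlaneGraph.edgeFactor_mul_sub_mem`), and the signs make the squares anticommute.

Finally, the cube of a diagram with some crossings resolved is a face of the cube of `D`. The
restriction of functions on states to a face, with signs that correct the signs of the edges,
commutes with the differential as far as the differential does not lead into the face from outside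
(`LinkDiagram.IsFace.faceMap_unnormalisedD`). On `F^k` this is the case for the faces of `D^k` and
of `D̃^{k+1}`. The restriction to the former is bijective, and the kernel of the restriction to
the latter is `F^{k+1}`. The shifts of degrees are obtained by counting crossings: `A_k = n_0^- -
n_k^- - k` and `B_k = 3 A_k + k`.
-/

noncomputable section

/-! ### The spectral sequence of a filtered complex -/

section FilteredComplexes

variable {R : Type u} [CommRing R] {C : ℤ → Type u} [∀ n, AddCommGroup (C n)]
  [∀ n, Module R (C n)]

/-- `(C, d, F)` is a complex filtered by a decreasing family of subcomplexes. The components of `d`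
between arbitrary degrees are included, so that equal degrees need not be syntactically equal. -/
structure IsFilteredComplex (d : ∀ n n' : ℤ, C n →ₗ[R] C n')
    (F : ℤ → ∀ n, Submodule R (C n)) : Prop where
  d_d : ∀ n n' n'' x, d n' n'' (d n n' x) = 0
  d_mem : ∀ s n n' x, x ∈ F s n → d n n' x ∈ F s n'
  anti : ∀ n, Antitone fun s => F s n

variable {d : ∀ n n' : ℤ, C n →ₗ[R] C n'} {F : ℤ → ∀ n, Submodule R (C n)}

lemma mem_approxCycles {r s n n' : ℤ} (hn : n' = n + 1) {x : C n} :
    x ∈ approxCycles d F r s n ↔ x ∈ F s n ∧ d n n' x ∈ F (s + r) n' := by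
  subst hn; rfl

lemma mem_approxBoundaries {r s s' n n' : ℤ} (hs : s' + r = s + 1) (hn : n' + 1 = n) {x : C n} :
    x ∈ approxBoundaries d F r s n ↔
      ∃ a ∈ approxCycles d F (r - 1) (s + 1) n, ∃ b ∈ approxCycles d F (r - 1) s' n',
        a + d n' n b = x := by
  obtain rfl : s' = s - r + 1 := by lia
  obtain rfl : n' = n - 1 := by lia
  simp [approxBoundaries, Submodule.mem_sup]

lemma page_mk_eq_zero {r s n : ℤ} {z : approxCycles d F r s n} :
    (Submodule.Quotient.mk z : FilteredPage d F r s n) = 0 ↔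
      z.1 ∈ approxBoundaries d F r s n := by
  rw [Submodule.Quotient.mk_eq_zero]; rfl

lemma page_mk_eq_mk {r s n : ℤ} {z w : approxCycles d F r s n} :
    (Submodule.Quotient.mk z : FilteredPage d F r s n) = Submodule.Quotient.mk w ↔
      z.1 - w.1 ∈ approxBoundaries d F r s n := by
  rw [Submodule.Quotient.eq]; rfl

namespace IsFilteredComplex

section

variable (H : IsFilteredComplex d F)
include H

lemma approxCycles_anti {r r' s n : ℤ} (h : r ≤ r') :
    approxCycles d F r' s n ≤ approxCycles d F r s n :=
  fun _ hx => ⟨hx.1, H.anti _ (by lia) hx.2⟩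

lemma map_approxCycles {r s s' n n' : ℤ} (hs : s' = s + r) (hn : n' = n + 1) {x : C n}
    (hx : x ∈ approxCycles d F r s n) : d n n' x ∈ approxCycles d F r s' n' := by
  subst hs
  rw [mem_approxCycles hn] at hx
  rw [mem_approxCycles rfl, H.d_d]
  exact ⟨hx.2, zero_mem _⟩

lemma map_approxBoundaries {r s s' n n' : ℤ} (hs : s' = s + r) (hn : n' = n + 1) {x : C n}
    (hx : x ∈ approxBoundaries d F r s n) : d n n' x ∈ approxBoundaries d F r s' n' := by
  obtain ⟨a, ha, b, -, rfl⟩ := (mem_approxBoundaries (s' := s - r + 1) (n' := n - 1)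
    (by lia) (by lia)).1 hx
  refine (mem_approxBoundaries (s' := s + 1) (by lia) hn.symm).2 ⟨0, zero_mem _, a, ha, ?_⟩
  simp [H.d_d]

/-- The differential of the page `r`, induced by `d`. -/
def pageD {r s s' n n' : ℤ} (hs : s' = s + r) (hn : n' = n + 1) :
    FilteredPage d F r s n →ₗ[R] FilteredPage d F r s' n' :=
  Submodule.mapQ _ _ ((d n n').restrict fun _ hx => H.map_approxCycles hs hn hx)
    fun _ hx => H.map_approxBoundaries hs hn hx

lemma pageD_mk {r s s' n n' : ℤ} (hs : s' = s + r) (hn : n' = n + 1)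
    (z : approxCycles d F r s n) :
    H.pageD hs hn (Submodule.Quotient.mk z) =
      Submodule.Quotient.mk ⟨d n n' z.1, H.map_approxCycles hs hn z.2⟩ := rfl

lemma pageD_pageD {r s s' s'' n n' n'' : ℤ} (hs : s' = s + r) (hn : n' = n + 1)
    (hs' : s'' = s' + r) (hn' : n'' = n' + 1) (y : FilteredPage d F r s n) :
    H.pageD hs' hn' (H.pageD hs hn y) = 0 := by
  obtain ⟨z, rfl⟩ := Submodule.Quotient.mk_surjective _ y
  rw [pageD_mk, pageD_mk, page_mk_eq_zero]
  simp [H.d_d]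

open Classical in
/-- The page `r` as a complex. -/
def page (r : ℤ) : HomologicalComplex (ModuleCat.{u} R)
    (ComplexShape.up' ((r, 1 - r) : ℤ × ℤ)) where
  X p := ModuleCat.of R (FilteredPage d F r p.1 (p.1 + p.2))
  d p q := if h : q.1 = p.1 + r ∧ q.1 + q.2 = p.1 + p.2 + 1 then
    ModuleCat.ofHom (H.pageD h.1 h.2) else 0
  shape p q h := by
    refine dif_neg fun h' => h ?_
    ext <;> simp <;> lia
  d_comp_d' p q t _ _ := by
    by_cases h : q.1 = p.1 + r ∧ q.1 + q.2 = p.1 + p.2 + 1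
    · by_cases h' : t.1 = q.1 + r ∧ t.1 + t.2 = q.1 + q.2 + 1
      · rw [dif_pos h, dif_pos h']
        ext1
        exact LinearMap.ext fun y => H.pageD_pageD h.1 h.2 h'.1 h'.2 y
      · rw [dif_neg h', Limits.comp_zero]
    · rw [dif_neg h, Limits.zero_comp]

lemma page_d {r : ℤ} {p q : ℤ × ℤ} (h : q.1 = p.1 + r) (h' : q.1 + q.2 = p.1 + p.2 + 1) :
    (H.page r).d p q = ModuleCat.ofHom (H.pageD h h') :=
  dif_pos ⟨h, h'⟩

/-- The map that sends an element of `Z_{r+1}^s` to its class in `E_r^s`, which is a cycle. -/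
def toPageCycles (r : ℤ) (p : ℤ × ℤ) : approxCycles d F (r + 1) p.1 (p.1 + p.2) →ₗ[R]
    LinearMap.ker ((H.page r).sc p).g.hom :=
  ((Submodule.mkQ _).comp (Submodule.inclusion (H.approxCycles_anti (by lia)))).codRestrict _
    fun z => by
      change ((H.page r).d p _).hom _ = 0
      obtain ⟨q, hq, h1, h2⟩ : ∃ q, (ComplexShape.up' ((r, 1 - r) : ℤ × ℤ)).next p = q ∧
          q.1 = p.1 + r ∧ q.1 + q.2 = p.1 + p.2 + 1 :=
        ⟨_, ComplexShape.next_eq' _ rfl, rfl, by simp; lia⟩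
      rw [hq, H.page_d h1 h2]
      change H.pageD h1 h2 (Submodule.Quotient.mk _) = 0
      rw [pageD_mk, page_mk_eq_zero, mem_approxBoundaries (s' := p.1 + 1) (by lia) h2.symm]
      have hz := (mem_approxCycles h2).1 z.2
      refine ⟨d _ _ z.1, (mem_approxCycles rfl).2 ⟨?_, ?_⟩, 0, zero_mem _, ?_⟩
      · convert! hz.2 using 2; lia
      · rw [H.d_d]; exact zero_mem _
      · simp

/-- If `d_r [z] = 0`, then `d z = a + d b` with `a` in `F^{s+r+1}` and `b` in `Z_{r-1}^{s+1}`.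
So `z - b` is a representative in `Z_{r+1}^s` of the class of `z`. -/
lemma toPageCycles_surjective (r : ℤ) (p : ℤ × ℤ) :
    Function.Surjective (H.toPageCycles r p) := by
  rintro ⟨y, hy⟩
  obtain ⟨z, rfl⟩ := Submodule.Quotient.mk_surjective _ y
  have hy' : ((H.page r).d p _).hom (Submodule.Quotient.mk z) = 0 := hy
  obtain ⟨q, hq, h1, h2⟩ : ∃ q, (ComplexShape.up' ((r, 1 - r) : ℤ × ℤ)).next p = q ∧
      q.1 = p.1 + r ∧ q.1 + q.2 = p.1 + p.2 + 1 :=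
    ⟨_, ComplexShape.next_eq' _ rfl, rfl, by simp; lia⟩
  rw [hq, H.page_d h1 h2] at hy'
  replace hy' : H.pageD h1 h2 (Submodule.Quotient.mk z) = 0 := hy'
  rw [pageD_mk, page_mk_eq_zero, mem_approxBoundaries (s' := p.1 + 1) (by lia) h2.symm] at hy'
  obtain ⟨a, ha, b, hb, hab⟩ := hy'
  replace hab : a + d _ _ b = d _ _ z.1 := hab
  have hb' := (mem_approxCycles h2).1 hb
  have hz := (mem_approxCycles h2).1 z.2
  refine ⟨⟨z.1 - b, (mem_approxCycles h2).2
    ⟨sub_mem hz.1 (H.anti _ (by lia) hb'.1), ?_⟩⟩, ?_⟩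
  · rw [map_sub, ← hab, add_sub_cancel_right, show p.1 + (r + 1) = q.1 + 1 by lia]
    exact ha.1
  · apply Subtype.ext
    refine (Submodule.Quotient.eq _).2 ?_
    change z.1 - b - z.1 ∈ approxBoundaries d F r p.1 (p.1 + p.2)
    rw [sub_sub_cancel_left]
    refine neg_mem ((mem_approxBoundaries (s' := p.1 - r + 1) (by lia) (sub_add_cancel _ 1)).2
      ⟨b, hb, 0, zero_mem _, by simp⟩)

/-- A cycle of the page `r` is a boundary if and only if its representatives
in `Z_{r+1}^s` lie in `Z_r^{s+1} + d Z_r^{s-r}`. -/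
lemma toPageCycles_mem_range (r : ℤ) (p : ℤ × ℤ)
    (z : approxCycles d F (r + 1) p.1 (p.1 + p.2)) :
    H.toPageCycles r p z ∈ LinearMap.range ((H.page r).sc p).moduleCatToCycles ↔
      z.1 ∈ approxBoundaries d F (r + 1) p.1 (p.1 + p.2) := by
  have key : H.toPageCycles r p z ∈ LinearMap.range ((H.page r).sc p).moduleCatToCycles ↔
      ∃ x, ((H.page r).d ((ComplexShape.up' ((r, 1 - r) : ℤ × ℤ)).prev p) p).hom x =
        (H.toPageCycles r p z).1 := by
    constructor
    · rintro ⟨x, hx⟩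
      exact ⟨x, congrArg Subtype.val hx⟩
    · rintro ⟨x, hx⟩
      exact ⟨x, Subtype.ext hx⟩
  rw [key]
  obtain ⟨q, hq, h1, h2⟩ : ∃ q, (ComplexShape.up' ((r, 1 - r) : ℤ × ℤ)).prev p = q ∧
      p.1 = q.1 + r ∧ p.1 + p.2 = q.1 + q.2 + 1 := by
    refine ⟨(p.1 - r, p.2 - (1 - r)), ComplexShape.prev_eq' _ ?_, ?_, ?_⟩
    · ext <;> simp
    · simp
    · simp; lia
  rw [hq, H.page_d h1 h2, mem_approxBoundaries (s' := q.1) (by lia) h2.symm]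
  have hz := (mem_approxCycles (n' := p.1 + p.2 + 1) rfl).1 z.2
  constructor
  · rintro ⟨y, hy⟩
    obtain ⟨x, rfl⟩ := Submodule.Quotient.mk_surjective _ y
    replace hy : H.pageD h1 h2 (Submodule.Quotient.mk x) =
      Submodule.Quotient.mk ⟨z.1, H.approxCycles_anti (by lia) z.2⟩ := hy
    rw [pageD_mk, page_mk_eq_mk] at hy
    obtain ⟨a, ha, b, hb, hab⟩ := (mem_approxBoundaries (s' := q.1 + 1) (by lia) h2.symm).1 hy
    have ha' := (mem_approxCycles (n' := p.1 + p.2 + 1) rfl).1 ha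
    have hb' := (mem_approxCycles h2).1 hb
    have hx := (mem_approxCycles h2).1 x.2
    refine ⟨-a, ?_, x.1 - b, ?_, ?_⟩
    · refine neg_mem ((mem_approxCycles (n' := p.1 + p.2 + 1) rfl).2 ⟨ha'.1, ?_⟩)
      obtain rfl : a = d _ _ x.1 - z.1 - d _ _ b := by rw [← hab]; abel
      rw [map_sub, map_sub, H.d_d, H.d_d, zero_sub, sub_zero]
      refine neg_mem ?_
      convert! hz.2 using 2; lia
    · refine (mem_approxCycles h2).2 ⟨sub_mem hx.1 (H.anti _ (by lia) hb'.1), ?_⟩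
      rw [map_sub]
      refine sub_mem ?_ ?_
      · convert! hx.2 using 2; lia
      · convert! hb'.2 using 2; lia
    · rw [map_sub]
      have : d _ _ x.1 = a + d _ _ b + z.1 := by rw [hab]; abel
      rw [this]; abel
  · rintro ⟨a, ha, x, hx, hax⟩
    have ha' := (mem_approxCycles (n' := p.1 + p.2 + 1) rfl).1 ha
    rw [add_sub_cancel_right] at ha hx
    refine ⟨Submodule.Quotient.mk ⟨x, hx⟩, ?_⟩
    change H.pageD h1 h2 (Submodule.Quotient.mk ⟨x, hx⟩) =
      Submodule.Quotient.mk ⟨z.1, H.approxCycles_anti (by lia) z.2⟩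
    rw [pageD_mk, page_mk_eq_mk]
    refine (mem_approxBoundaries (s' := q.1 + 1) (by lia) h2.symm).2
      ⟨-a, neg_mem ((mem_approxCycles (n' := p.1 + p.2 + 1) rfl).2 ⟨ha'.1, ?_⟩), 0,
        zero_mem _, ?_⟩
    · exact H.anti _ (by lia) ha'.2
    · rw [← hax, map_zero]; abel

/-- The map that sends an element of `Z_{r+1}^s` to its class in the homology of the page `r`. -/
def toPageHomology (r : ℤ) (p : ℤ × ℤ) :
    approxCycles d F (r + 1) p.1 (p.1 + p.2) →ₗ[R] (H.page r).homology p :=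
  ((H.page r).sc p).moduleCatHomologyIso.inv.hom.comp
    ((Submodule.mkQ _).comp (H.toPageCycles r p))

lemma toPageHomology_surjective (r : ℤ) (p : ℤ × ℤ) :
    Function.Surjective (H.toPageHomology r p) :=
  (((H.page r).sc p).moduleCatHomologyIso.toLinearEquiv.symm.surjective).comp
    ((Submodule.mkQ_surjective _).comp (H.toPageCycles_surjective r p))

lemma ker_toPageHomology (r : ℤ) (p : ℤ × ℤ) :
    LinearMap.ker (H.toPageHomology r p) =
      (approxBoundaries d F (r + 1) p.1 (p.1 + p.2)).submoduleOf
        (approxCycles d F (r + 1) p.1 (p.1 + p.2)) := by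
  ext z
  rw [LinearMap.mem_ker]
  have h : H.toPageHomology r p z = 0 ↔
      (Submodule.Quotient.mk (H.toPageCycles r p z) : _ ⧸
        LinearMap.range ((H.page r).sc p).moduleCatToCycles) = 0 :=
    ((H.page r).sc p).moduleCatHomologyIso.toLinearEquiv.symm.map_eq_zero_iff
  rw [h, Submodule.Quotient.mk_eq_zero, toPageCycles_mem_range]
  rfl

/-- The homology of a page is the next page. -/
def pageIso (r : ℤ) (p : ℤ × ℤ) :
    FilteredPage d F (r + 1) p.1 (p.1 + p.2) ≃ₗ[R] (H.page r).homology p :=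
  (Submodule.quotEquivOfEq _ _ (H.ker_toPageHomology r p).symm).trans
    ((H.toPageHomology r p).quotKerEquivOfSurjective (H.toPageHomology_surjective r p))

/-- The spectral sequence of a filtered complex. -/
def spectralSequence : CohomologicalSpectralSequence (ModuleCat.{u} R) 1 where
  page r _ := H.page r
  iso r r' p h _ := (H.pageIso r p).symm.toModuleIso ≪≫
    eqToIso (by subst h; rfl : _ = (H.page r').X p)

/-- The spectral sequence has the standard subquotients as terms, by definition. -/
def spectralSequenceIso : FilteredComplexIso d F H.spectralSequence where
  e r _ s t := LinearEquiv.refl R (FilteredPage d F r s (s + t))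
  e_d r hr s t y z w hw hy := by
    have h1 : (s + r, t - r + 1).1 = (s, t).1 + r := rfl
    have h2 : (s + r, t - r + 1).1 + (s + r, t - r + 1).2 = (s, t).1 + (s, t).2 + 1 := by
      simp; lia
    change ((H.page r).d (s, t) (s + r, t - r + 1)).hom y = _
    rw [H.page_d h1 h2]
    change H.pageD h1 h2 y = _
    obtain rfl : y = Submodule.Quotient.mk z := hy
    rw [pageD_mk]
    congr 1
    exact Subtype.ext hw.symm
  e_iso r hr s t y z w hw hy := by
    change (H.pageIso r (s, t)).symm (((H.page r).sc (s, t)).homologyπ.hom y) = _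
    refine (LinearEquiv.symm_apply_eq (H.pageIso r (s, t))).2 ?_
    change _ = (((H.page r).sc (s, t)).moduleCatHomologyIso.inv.hom
      (((H.page r).sc (s, t)).moduleCatLeftHomologyData.π.hom (H.toPageCycles r (s, t) w)))
    have h := ConcreteCategory.congr_hom ((H.page r).sc (s, t)).moduleCatCyclesIso_inv_π
      (H.toPageCycles r (s, t) w)
    refine Eq.trans ?_ h
    change _ = ((H.page r).sc (s, t)).homologyπ.hom
      (((H.page r).sc (s, t)).moduleCatCyclesIso.inv.hom (H.toPageCycles r (s, t) w))
    congr 1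
    apply (ModuleCat.mono_iff_injective ((H.page r).sc (s, t)).iCycles).1 inferInstance
    refine Eq.trans (hy : _ = (Submodule.Quotient.mk z : FilteredPage d F r s (s + t))) ?_
    have h' := ConcreteCategory.congr_hom
      ((H.page r).sc (s, t)).moduleCatCyclesIso_inv_iCycles (H.toPageCycles r (s, t) w)
    refine Eq.trans ?_ h'.symm
    change (Submodule.Quotient.mk z : FilteredPage d F r s (s + t)) =
      Submodule.Quotient.mk ⟨w.1, _⟩
    congr 1
    exact Subtype.ext hw.symm

end

variable (H : IsFilteredComplex d F)

lemma subsingleton_page_of_eq_bot {r s n : ℤ} (h : F s n = ⊥) :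
    Subsingleton (FilteredPage d F r s n) := by
  refine ⟨fun y y' => ?_⟩
  obtain ⟨z, rfl⟩ := Submodule.Quotient.mk_surjective _ y
  obtain ⟨z', rfl⟩ := Submodule.Quotient.mk_surjective _ y'
  have hz (z : approxCycles d F r s n) : z.1 = 0 := by
    have hz : z.1 ∈ F s n := z.2.1
    rwa [h, Submodule.mem_bot] at hz
  rw [Subtype.ext ((hz z).trans (hz z').symm)]

/-- In the columns before the start of the filtration, `Z_r^s` equals `Z_{r-1}^{s+1}`. -/
lemma subsingleton_page_of_eq_top {r s n : ℤ} (h : F (s + 1) n = ⊤) :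
    Subsingleton (FilteredPage d F r s n) := by
  have hz (y : FilteredPage d F r s n) : y = 0 := by
    obtain ⟨z, rfl⟩ := Submodule.Quotient.mk_surjective _ y
    rw [page_mk_eq_zero, mem_approxBoundaries (s' := s - r + 1) (by lia) (sub_add_cancel n 1)]
    refine ⟨z.1, (mem_approxCycles rfl).2 ⟨h ▸ Submodule.mem_top, ?_⟩, 0, zero_mem _, by simp⟩
    have := z.2.2
    rwa [show s + 1 + (r - 1) = s + r by lia]
  exact ⟨fun y y' => (hz y).trans (hz y').symm⟩

include H in
lemma inducedFiltration_antitone (n : ℤ) : Antitone (inducedFiltration d F n) :=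
  fun _ _ h => Submodule.map_mono (Submodule.comap_mono (H.anti n h))

lemma approxCycles_le_ker {r s n : ℤ} (hbot : F (s + r) (n + 1) = ⊥) :
    approxCycles d F r s n ≤ LinearMap.ker (d n (n + 1)) :=
  fun x hx => by simpa [hbot] using ((mem_approxCycles rfl).1 hx).2

/-- The class in `Fil^s H / Fil^{s+1} H` of an element of `Z_r^s`, for `r` so large
that it is a cocycle. -/
def toGradedCohomology {r s n : ℤ} (hbot : F (s + r) (n + 1) = ⊥) :
    approxCycles d F r s n →ₗ[R] (inducedFiltration d F n s ⧸
      (inducedFiltration d F n (s + 1)).submoduleOf (inducedFiltration d F n s)) :=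
  (Submodule.mkQ _).comp
    (((Submodule.mkQ _).comp (Submodule.inclusion (approxCycles_le_ker hbot))).codRestrict _
        fun z => Submodule.mem_map_of_mem z.2.1)

lemma toGradedCohomology_surjective {r s n : ℤ} (hbot : F (s + r) (n + 1) = ⊥) :
    Function.Surjective (toGradedCohomology (d := d) hbot) := by
  intro y
  obtain ⟨⟨y, hy⟩, rfl⟩ := Submodule.Quotient.mk_surjective _ y
  obtain ⟨x, hx, rfl⟩ := hy
  refine ⟨⟨x.1, (mem_approxCycles rfl).2 ⟨hx, ?_⟩⟩, rfl⟩
  have : d n (n + 1) x.1 = 0 := x.2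
  rw [this]
  exact zero_mem _

include H in
lemma ker_toGradedCohomology {r s n : ℤ} (hbot : F (s + r) (n + 1) = ⊥)
    (htop : F (s - r + 1) (n - 1) = ⊤) :
    LinearMap.ker (toGradedCohomology (d := d) hbot) =
      (approxBoundaries d F r s n).submoduleOf (approxCycles d F r s n) := by
  ext z
  have h1 : z ∈ LinearMap.ker (toGradedCohomology (d := d) hbot) ↔
      ∃ y ∈ F (s + 1) n, ∃ hy : d n (n + 1) y = 0, ∃ w, d (n - 1) n w = y - z.1 := by
    rw [LinearMap.mem_ker]
    refine (Submodule.Quotient.mk_eq_zero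
      ((inducedFiltration d F n (s + 1)).submoduleOf (inducedFiltration d F n s))).trans ?_
    constructor
    · rintro ⟨y, hy, hyz⟩
      obtain ⟨w, hw⟩ := (Submodule.Quotient.eq _).1 hyz
      exact ⟨y.1, hy, y.2, w, hw⟩
    · rintro ⟨y, hy, hy', w, hw⟩
      exact ⟨⟨y, hy'⟩, hy, (Submodule.Quotient.eq _).2 ⟨w, hw⟩⟩
  have h2 : z ∈ (approxBoundaries d F r s n).submoduleOf (approxCycles d F r s n) ↔ _ :=
    mem_approxBoundaries (s' := s - r + 1) (by lia) (sub_add_cancel n 1)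
  rw [h1, h2]
  constructor
  · rintro ⟨y, hy, hy', w, hw⟩
    refine ⟨y, (mem_approxCycles rfl).2 ⟨hy, hy'.symm ▸ zero_mem _⟩, -w, neg_mem ?_,
      by simp [hw]⟩
    refine (mem_approxCycles (sub_add_cancel n 1).symm).2 ⟨htop ▸ Submodule.mem_top, ?_⟩
    rw [hw, show s - r + 1 + (r - 1) = s by lia]
    exact sub_mem (H.anti n (by lia) hy) z.2.1
  · rintro ⟨a, ha, b, hb, hab⟩
    replace hab : a + d (n - 1) n b = z.1 := hab
    refine ⟨a, ((mem_approxCycles rfl).1 ha).1, ?_, -b, by simp [← hab]⟩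
    have : d n (n + 1) z.1 = 0 := approxCycles_le_ker hbot z.2
    rwa [← hab, map_add, H.d_d, add_zero] at this

include H in
/-- A spectral sequence of a bounded filtration converges to the cohomology of the complex. -/
lemma convergesTo {lo hi : ℤ} (hlo : ∀ s n, s ≤ lo → F s n = ⊤)
    (hhi : ∀ s n, hi < s → F s n = ⊥) :
    ConvergesTo H.spectralSequence (Cohomology d) (inducedFiltration d F) where
  antitone := H.inducedFiltration_antitone
  exists_eq_top n := by
    refine ⟨lo, ?_⟩
    rw [inducedFiltration, hlo lo n le_rfl,
      show (⊤ : Submodule R (C n)).submoduleOf (LinearMap.ker (d n (n + 1))) = ⊤ from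
        Submodule.comap_top _, Submodule.map_top,
      Submodule.range_mkQ]
  exists_eq_bot n := by
    refine ⟨hi + 1, ?_⟩
    rw [inducedFiltration, hhi (hi + 1) n (by lia), eq_bot_iff]
    rintro _ ⟨x, hx, rfl⟩
    obtain rfl : x = 0 := Subtype.ext hx
    simp
  limit s t := by
    refine ⟨max (hi - s + 1) (s - lo + 1), fun r hr hr₀ => ⟨fun q => ?_, fun q => ?_, ⟨?_⟩⟩⟩
    · change (H.page r).d (s, t) q = 0
      by_cases hq : (ComplexShape.up' ((r, 1 - r) : ℤ × ℤ)).Rel (s, t) q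
      · have : q.1 = s + r := by rw [← hq]; rfl
        have := subsingleton_page_of_eq_bot (d := d) (r := r) (hhi q.1 (q.1 + q.2) (by lia))
        ext1
        exact LinearMap.ext fun y => Subsingleton.elim (α := FilteredPage d F r q.1 (q.1 + q.2)) _ _
      · exact (H.page r).shape _ _ hq
    · change (H.page r).d q (s, t) = 0
      by_cases hq : (ComplexShape.up' ((r, 1 - r) : ℤ × ℤ)).Rel q (s, t)
      · have : s = q.1 + r := congrArg Prod.fst hq.symm
        have := subsingleton_page_of_eq_top (d := d) (r := r)
          (hlo (q.1 + 1) (q.1 + q.2) (by lia))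
        ext1
        refine LinearMap.ext fun y => ?_
        obtain rfl : y = 0 := Subsingleton.elim (α := FilteredPage d F r q.1 (q.1 + q.2)) _ _
        simp
      · exact (H.page r).shape _ _ hq
    · have hbot := hhi (s + r) (s + t + 1) (by lia)
      exact (Submodule.quotEquivOfEq _ _ (H.ker_toGradedCohomology hbot
        (hlo (s - r + 1) (s + t - 1) (by lia))).symm).trans
          ((toGradedCohomology hbot).quotKerEquivOfSurjective
            (toGradedCohomology_surjective hbot))

section FirstPage

variable {C' : ℤ → Type u} [∀ n, AddCommGroup (C' n)] [∀ n, Module R (C' n)]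
  {d' : ∀ n n' : ℤ, C' n →ₗ[R] C' n'} {s n n' : ℤ}
  {p₀ : F s (n - 1) →ₗ[R] C' (n' - 1)} {p₁ : F s n →ₗ[R] C' n'}
  {p₂ : F s (n + 1) →ₗ[R] C' (n' + 1)}

include H in
/-- If `C'` is a quotient of `F^s` by `F^{s+1}` in the degrees `n - 1`, `n`, `n + 1`, then the term
of total degree `n` in the column `s` of the first page is the cohomology of `C'`. -/
lemma nonempty_firstPage_equiv (hp₀ : Function.Surjective p₀) (hp₁ : Function.Surjective p₁)
    (hk₁ : ∀ x, p₁ x = 0 ↔ x.1 ∈ F (s + 1) n) (hk₂ : ∀ x, p₂ x = 0 ↔ x.1 ∈ F (s + 1) (n + 1))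
    (hc₀ : ∀ x y, y.1 = d (n - 1) n x.1 → p₁ y = d' (n' - 1) n' (p₀ x))
    (hc₁ : ∀ x y, y.1 = d n (n + 1) x.1 → p₂ y = d' n' (n' + 1) (p₁ x)) :
    Nonempty (FilteredPage d F 1 s n ≃ₗ[R] Cohomology d' n') := by
  let u : approxCycles d F 1 s n →ₗ[R] Cohomology d' n' :=
    (Submodule.mkQ _).comp ((p₁.comp (Submodule.inclusion inf_le_left)).codRestrict _ fun z => by
      have hz : p₂ ⟨d n (n + 1) z.1, H.d_mem _ _ _ _ z.2.1⟩ = 0 := (hk₂ _).2 z.2.2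
      exact (hc₁ ⟨z.1, z.2.1⟩ _ rfl).symm.trans hz)
  have hu : Function.Surjective u := by
    intro y
    obtain ⟨⟨y, hy⟩, rfl⟩ := Submodule.Quotient.mk_surjective _ y
    obtain ⟨x, rfl⟩ := hp₁ y
    refine ⟨⟨x.1, x.2, ?_⟩, rfl⟩
    exact (hk₂ ⟨d n (n + 1) x.1, H.d_mem _ _ _ _ x.2⟩).1 ((hc₁ x _ rfl).trans hy)
  have hker : LinearMap.ker u =
      (approxBoundaries d F 1 s n).submoduleOf (approxCycles d F 1 s n) := by
    ext z
    have h1 : z ∈ LinearMap.ker u ↔ ∃ w, d' (n' - 1) n' w = p₁ ⟨z.1, z.2.1⟩ :=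
      (Submodule.Quotient.mk_eq_zero _).trans Iff.rfl
    have h2 : z ∈ (approxBoundaries d F 1 s n).submoduleOf (approxCycles d F 1 s n) ↔ _ :=
      mem_approxBoundaries (s' := s) rfl (sub_add_cancel n 1)
    rw [h1, h2]
    constructor
    · rintro ⟨w, hw⟩
      obtain ⟨w, rfl⟩ := hp₀ w
      have hdw := H.d_mem s (n - 1) n _ w.2
      rw [← hc₀ w ⟨_, hdw⟩ rfl] at hw
      have hmem : p₁ (⟨z.1, z.2.1⟩ - ⟨_, hdw⟩) = 0 := by rw [map_sub, hw, sub_self]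
      refine ⟨z.1 - d (n - 1) n w.1, (mem_approxCycles rfl).2 ⟨(hk₁ _).1 hmem, ?_⟩,
        w.1, (mem_approxCycles (sub_add_cancel n 1).symm).2 ⟨w.2, ?_⟩, by simp⟩
      · rw [map_sub, H.d_d, sub_zero, sub_self, add_zero]
        exact z.2.2
      · rwa [sub_self, add_zero]
    · rintro ⟨a, ha, b, hb, hab⟩
      have ha' := ((mem_approxCycles rfl).1 ha).1
      have hb' := ((mem_approxCycles rfl).1 hb).1
      refine ⟨p₀ ⟨b, hb'⟩, ?_⟩
      rw [← hc₀ ⟨b, hb'⟩ ⟨_, H.d_mem s (n - 1) n _ hb'⟩ rfl, eq_comm, ← sub_eq_zero, ← map_sub,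
        hk₁]
      replace hab : a + d (n - 1) n b = z.1 := hab
      change z.1 - d (n - 1) n b ∈ _
      rwa [← hab, add_sub_cancel_right]
  exact ⟨(Submodule.quotEquivOfEq _ _ hker.symm).trans (u.quotKerEquivOfSurjective hu)⟩

end FirstPage

end IsFilteredComplex

end FilteredComplexes

/-! ### Alternating orientations of plane graphs -/

lemma Equiv.Perm.SameCycle.map_eq_map {X Y : Type*} {g : Equiv.Perm X} {f : X → Y}
    (h : ∀ x, f (g x) = f x) {x y : X} (hxy : g.SameCycle x y) : f x = f y := by
  obtain ⟨i, rfl⟩ := hxy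
  induction i with
  | zero => rfl
  | succ i ih => rw [add_comm, zpow_add, zpow_one, Equiv.Perm.mul_apply, h, ih]
  | pred i ih =>
    rw [ih, ← h ((g ^ (-(i : ℤ) - 1)) x), ← Equiv.Perm.mul_apply, ← zpow_one_add]
    congr 3; lia

section InvariantFunctions

variable (K : Type*) [Field K] {X : Type*}

/-- The functions that are constant on the classes of an equivalence relation. -/
def invariantFunctions (r : Setoid X) : Submodule K (X → K) where
  carrier := {f | ∀ x y, r x y → f x = f y}
  zero_mem' := fun _ _ _ => rfl
  add_mem' := fun hf hg x y h => by simp [hf x y h, hg x y h]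
  smul_mem' := fun c _ hf x y h => by simp [hf x y h]

lemma finrank_invariantFunctions [Finite X] (r : Setoid X) :
    Module.finrank K (invariantFunctions K r) = Nat.card (Quotient r) := by
  have : Fintype (Quotient r) := Fintype.ofFinite _
  let e : (Quotient r → K) →ₗ[K] invariantFunctions K r :=
    (LinearMap.funLeft K K (Quotient.mk r)).codRestrict _
      fun f x y h => congrArg f (Quotient.sound h)
  have he : Function.Bijective e := by
    constructor
    · intro f g h
      funext q
      obtain ⟨x, rfl⟩ := Quotient.mk_surjective q
      exact congrFun (congrArg Subtype.val h) x
    · rintro ⟨f, hf⟩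
      exact ⟨Quotient.lift f hf, rfl⟩
  rw [← (LinearEquiv.ofBijective e he).finrank_eq, Module.finrank_fintype_fun_eq_card,
    Nat.card_eq_fintype_card]

lemma mem_invariantFunctions_sameCycle {g : Equiv.Perm X} {f : X → K} :
    f ∈ invariantFunctions K (Equiv.Perm.SameCycle.setoid g) ↔ ∀ x, f (g x) = f x := by
  constructor
  · intro h x
    exact h _ _ (Equiv.Perm.sameCycle_apply_left.2 (Equiv.Perm.SameCycle.refl g x))
  · exact fun h x y hxy => hxy.map_eq_map h

lemma mem_invariantFunctions_orbitRel {s : Set (Equiv.Perm X)} {f : X → K} :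
    f ∈ invariantFunctions K (MulAction.orbitRel (Subgroup.closure s) X) ↔
      ∀ g ∈ s, ∀ x, f (g x) = f x := by
  constructor
  · intro h g hg x
    exact h _ _ ⟨⟨g, Subgroup.subset_closure hg⟩, rfl⟩
  · rintro h _ y ⟨⟨g, hg⟩, rfl⟩
    change f (g y) = f y
    induction hg using Subgroup.closure_induction generalizing y with
    | mem g hg => exact h g hg y
    | one => rfl
    | mul a b _ _ ha hb => rw [Equiv.Perm.mul_apply, ha, hb]
    | inv a _ ha => rw [← ha (a⁻¹ y), show a (a⁻¹ y) = y from a.apply_symm_apply y]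

end InvariantFunctions

namespace PlaneGraph

variable (G : PlaneGraph)

/-- A function that distinguishes the two halves of each edge. -/
lemma exists_edge_section : ∃ g : G.Dart → ZMod 2, ∀ x, g x + g (G.edge x) = 1 := by
  classical
  let e : G.Dart ≃ Fin (G.n * 4) := finProdFinEquiv
  refine ⟨fun x => if e x < e (G.edge x) then 1 else 0, fun x => ?_⟩
  simp only [G.edge_edge]
  rcases lt_trichotomy (e x) (e (G.edge x)) with h | h | h
  · rw [if_pos h, if_neg h.not_gt, add_zero]
  · exact absurd (e.injective h).symm (G.edge_ne x)
  · rw [if_neg h.not_gt, if_pos h, zero_add]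

/-- The number of edges is `2 n`. -/
lemma finrank_invariantFunctions_edge :
    Module.finrank (ZMod 2)
      (invariantFunctions (ZMod 2) (Equiv.Perm.SameCycle.setoid G.edge)) = 2 * G.n := by
  let T : (G.Dart → ZMod 2) →ₗ[ZMod 2] (G.Dart → ZMod 2) :=
    LinearMap.id + LinearMap.funLeft _ _ G.edge
  have hT (f x) : T f x = f x + f (G.edge x) := rfl
  have hker : LinearMap.ker T =
      invariantFunctions (ZMod 2) (Equiv.Perm.SameCycle.setoid G.edge) := by
    ext f
    rw [mem_invariantFunctions_sameCycle, LinearMap.mem_ker]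
    refine ⟨fun h x => ?_, fun h => funext fun x => ?_⟩
    · exact (CharTwo.add_eq_zero.1 ((hT f x).symm.trans (congrFun h x))).symm
    · rw [hT, h, CharTwo.add_self_eq_zero]; rfl
  have hrange : LinearMap.range T =
      invariantFunctions (ZMod 2) (Equiv.Perm.SameCycle.setoid G.edge) := by
    ext f
    rw [mem_invariantFunctions_sameCycle, LinearMap.mem_range]
    refine ⟨?_, fun h => ?_⟩
    · rintro ⟨f, rfl⟩ x
      rw [hT, hT, G.edge_edge, add_comm]
    · obtain ⟨g, hg⟩ := G.exists_edge_section
      refine ⟨g * f, funext fun x => ?_⟩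
      rw [hT, Pi.mul_apply, Pi.mul_apply, h, ← add_mul, hg, one_mul]
  have := T.finrank_range_add_finrank_ker
  rw [hker, hrange, Module.finrank_fintype_fun_eq_card, Fintype.card_prod, Fintype.card_fin,
    Fintype.card_fin] at this
  lia

open Classical in
/-- The matrix over `ZMod 2` of the map that assigns to a function on the vertices
its coboundary, as a function on the half-edges. -/
def coboundaryMatrix : Matrix G.Dart G.Vertex (ZMod 2) :=
  Matrix.of fun x v => (if x.1 = v then 1 else 0) + if (G.edge x).1 = v then 1 else 0

lemma coboundaryMatrix_mulVec (h : G.Vertex → ZMod 2) (x : G.Dart) :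
    (G.coboundaryMatrix.mulVec h) x = h x.1 + h (G.edge x).1 := by
  simp [coboundaryMatrix, Matrix.mulVec, dotProduct, add_mul, Finset.sum_add_distrib]

lemma sum_dart_comp_edge (f : G.Dart → ZMod 2) : ∑ x, f (G.edge x) = ∑ x, f x :=
  Equiv.sum_comp G.edge f

lemma coboundaryMatrix_transpose_mulVec (f : G.Dart → ZMod 2) (v : G.Vertex) :
    (G.coboundaryMatrix.transpose.mulVec f) v = ∑ i : Fin 4, (f (v, i) + f (G.edge (v, i))) := by
  classical
  have h : (G.coboundaryMatrix.transpose.mulVec f) v =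
      (∑ x : G.Dart, if x.1 = v then f x else 0) +
        ∑ x : G.Dart, if (G.edge x).1 = v then f x else 0 := by
    simp [coboundaryMatrix, Matrix.mulVec, dotProduct, add_mul, Finset.sum_add_distrib]
  have h' : (∑ x : G.Dart, if (G.edge x).1 = v then f x else 0) =
      ∑ x : G.Dart, if x.1 = v then f (G.edge x) else 0 := by
    rw [← G.sum_dart_comp_edge]
    simp [G.edge_edge]
  rw [h, h', Finset.sum_add_distrib, Fintype.sum_prod_type, Fintype.sum_prod_type]
  congr 1
  · rw [Finset.sum_eq_single v (fun w _ hw => by simp [hw]) (by simp)]; simp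
  · rw [Finset.sum_eq_single v (fun w _ hw => by simp [hw]) (by simp)]; simp

/-- A function on the vertices with coboundary zero is a function on the connected components. -/
lemma finrank_ker_coboundaryMatrix :
    Module.finrank (ZMod 2) (LinearMap.ker G.coboundaryMatrix.mulVecLin) =
      Module.finrank (ZMod 2) (invariantFunctions (ZMod 2) (MulAction.orbitRel
        (Subgroup.closure ({rotateDart G.n, G.edge} : Set (Equiv.Perm (Fin G.n × Fin 4))))
          (Fin G.n × Fin 4))) := by
  have hmem (h : G.Vertex → ZMod 2) : h ∈ LinearMap.ker G.coboundaryMatrix.mulVecLin ↔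
      ∀ x : G.Dart, h (G.edge x).1 = h x.1 := by
    rw [LinearMap.mem_ker]
    refine ⟨fun hh x => ?_, fun hh => funext fun x => ?_⟩
    · exact (CharTwo.add_eq_zero.1
        ((G.coboundaryMatrix_mulVec h x).symm.trans (congrFun hh x))).symm
    · rw [Matrix.mulVecLin_apply, coboundaryMatrix_mulVec, hh, CharTwo.add_self_eq_zero]; rfl
  let e : LinearMap.ker G.coboundaryMatrix.mulVecLin →ₗ[ZMod 2]
      invariantFunctions (ZMod 2) (MulAction.orbitRel
        (Subgroup.closure ({rotateDart G.n, G.edge} : Set (Equiv.Perm (Fin G.n × Fin 4))))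
          (Fin G.n × Fin 4)) :=
    ((LinearMap.funLeft _ _ Prod.fst).comp (Submodule.subtype _)).codRestrict _ fun h => by
      rw [mem_invariantFunctions_orbitRel]
      rintro g (rfl | rfl) x
      · rfl
      · exact (hmem _).1 h.2 x
  refine (LinearEquiv.ofBijective e ⟨fun h h' hh => ?_, ?_⟩).finrank_eq
  · refine Subtype.ext (funext fun v => ?_)
    exact congrFun (congrArg Subtype.val hh) (v, 0)
  · rintro ⟨f, hf⟩
    rw [mem_invariantFunctions_orbitRel] at hf
    have hrot (v : G.Vertex) (i : Fin 4) : f (v, i + 1) = f (v, i) :=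
      hf _ (Set.mem_insert _ _) (v, i)
    have hconst (v : G.Vertex) (i : Fin 4) : f (v, i) = f (v, 0) := by
      have h0 := hrot v 0
      have h1 := hrot v 1
      have h2 := hrot v 2
      fin_cases i
      · rfl
      · exact h0
      · exact h1.trans h0
      · exact h2.trans (h1.trans h0)
    refine ⟨⟨fun v => f (v, 0), (hmem _).2 fun x => ?_⟩, Subtype.ext (funext fun x => ?_)⟩
    · rw [← hconst _ (G.edge x).2, ← hconst _ x.2]
      exact hf _ (Set.mem_insert_of_mem _ rfl) x
    · exact (hconst x.1 x.2).symm

lemma invariantFunctions_inf :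
    invariantFunctions (ZMod 2) (Equiv.Perm.SameCycle.setoid (rotateDart G.n * G.edge)) ⊓
      invariantFunctions (ZMod 2) (Equiv.Perm.SameCycle.setoid G.edge) =
    invariantFunctions (ZMod 2) (MulAction.orbitRel
      (Subgroup.closure ({rotateDart G.n, G.edge} : Set (Equiv.Perm (Fin G.n × Fin 4))))
        (Fin G.n × Fin 4)) := by
  ext f
  rw [Submodule.mem_inf, mem_invariantFunctions_sameCycle, mem_invariantFunctions_sameCycle,
    mem_invariantFunctions_orbitRel]
  constructor
  · rintro ⟨h1, h2⟩ g (rfl | rfl) x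
    · have := h1 (G.edge x)
      rwa [Equiv.Perm.mul_apply, G.edge_edge, h2] at this
    · exact h2 x
  · intro h
    refine ⟨fun x => ?_, h _ (Set.mem_insert_of_mem _ rfl)⟩
    rw [Equiv.Perm.mul_apply, h _ (Set.mem_insert _ _), h _ (Set.mem_insert_of_mem _ rfl)]

/-- The exactness that Euler's formula amounts to. Functions on faces and on edges, regarded as
functions on half-edges, lie in the kernel of the transposed coboundary matrix. By Euler's formula
both sides have the dimension `3 n + C`. -/
lemma sup_eq_ker :
    invariantFunctions (ZMod 2) (Equiv.Perm.SameCycle.setoid (rotateDart G.n * G.edge)) ⊔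
      invariantFunctions (ZMod 2) (Equiv.Perm.SameCycle.setoid G.edge) =
    LinearMap.ker G.coboundaryMatrix.transpose.mulVecLin := by
  refine Submodule.eq_of_le_of_finrank_eq (sup_le (fun f hf => ?_) fun f hf => ?_) ?_
  · rw [mem_invariantFunctions_sameCycle] at hf
    have hf' (x : G.Dart) : f (G.edge x) = f (rotateDart G.n x) := by
      rw [← hf (G.edge x), Equiv.Perm.mul_apply, G.edge_edge]
    refine funext fun v => ?_
    rw [Matrix.mulVecLin_apply, coboundaryMatrix_transpose_mulVec, Finset.sum_add_distrib]
    simp only [hf']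
    have : ∑ i : Fin 4, f (rotateDart G.n (v, i)) = ∑ i : Fin 4, f (v, i) :=
      Equiv.sum_comp (Equiv.addRight (1 : Fin 4)) fun i => f (v, i)
    rw [this, CharTwo.add_self_eq_zero]; rfl
  · rw [mem_invariantFunctions_sameCycle] at hf
    refine funext fun v => ?_
    rw [Matrix.mulVecLin_apply, coboundaryMatrix_transpose_mulVec]
    simp [hf, CharTwo.add_self_eq_zero]
  · have h1 := Submodule.finrank_sup_add_finrank_inf_eq
      (invariantFunctions (ZMod 2) (Equiv.Perm.SameCycle.setoid (rotateDart G.n * G.edge)))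
      (invariantFunctions (ZMod 2) (Equiv.Perm.SameCycle.setoid G.edge))
    have h2 := G.coboundaryMatrix.mulVecLin.finrank_range_add_finrank_ker
    have h3 := G.coboundaryMatrix.transpose.mulVecLin.finrank_range_add_finrank_ker
    have h4 : Module.finrank (ZMod 2) (LinearMap.range G.coboundaryMatrix.transpose.mulVecLin) =
        Module.finrank (ZMod 2) (LinearMap.range G.coboundaryMatrix.mulVecLin) :=
      Matrix.rank_transpose G.coboundaryMatrix
    have h5 : _ = G.n + 2 * Nat.card (Quotient (MulAction.orbitRel
      (Subgroup.closure ({rotateDart G.n, G.edge} : Set (Equiv.Perm (Fin G.n × Fin 4))))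
        (Fin G.n × Fin 4))) := G.planar
    rw [invariantFunctions_inf, finrank_invariantFunctions_edge] at h1
    rw [finrank_ker_coboundaryMatrix] at h2
    rw [finrank_invariantFunctions] at h1 h2
    rw [finrank_invariantFunctions] at h1
    rw [Module.finrank_fintype_fun_eq_card, Fintype.card_fin] at h2
    rw [Module.finrank_fintype_fun_eq_card, Fintype.card_prod, Fintype.card_fin,
      Fintype.card_fin] at h3
    lia

/-- The faces of a plane four-valent graph can be coloured like a checkerboard. So its edges can be
oriented in such a way that the orientations alternate around each vertex. -/
lemma exists_alternating : ∃ dir : G.Dart → Bool, (∀ x, dir (G.edge x) = !dir x) ∧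
    ∀ v i, dir (v, i + 1) = !dir (v, i) := by
  obtain ⟨g, hg⟩ := G.exists_edge_section
  have hmem : g ∈ LinearMap.ker G.coboundaryMatrix.transpose.mulVecLin := by
    refine funext fun v => ?_
    rw [Matrix.mulVecLin_apply, coboundaryMatrix_transpose_mulVec]
    simp only [hg, Finset.sum_const, Finset.card_univ, Fintype.card_fin]
    rfl
  rw [← sup_eq_ker, Submodule.mem_sup] at hmem
  obtain ⟨f, hf, k, hk, rfl⟩ := hmem
  rw [mem_invariantFunctions_sameCycle] at hf hk
  have h1 (x : G.Dart) : f (G.edge x) = f x + 1 := by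
    have := hg x
    simp only [Pi.add_apply, hk] at this
    rw [← this]
    have h2 := CharTwo.add_self_eq_zero (f x)
    have h3 := CharTwo.add_self_eq_zero (k x)
    linear_combination -h2 - h3
  have h2 (x : G.Dart) : f (rotateDart G.n x) = f x + 1 := by
    rw [← h1, ← hf (G.edge x), Equiv.Perm.mul_apply, G.edge_edge]
  have h3 (a : ZMod 2) : decide (a + 1 = 1) = !decide (a = 1) := by
    revert a; decide
  exact ⟨fun x => decide (f x = 1), fun x => by simp only [h1, h3],
    fun v i => by simp only [← h3, ← h2]; rfl⟩

end PlaneGraph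

/-! ### How the circles change with a smoothing -/

/-- Composition with the transposition of two points joins their cycles if these are
different, and separates the points otherwise. -/
lemma Equiv.Perm.sameCycle_swap_mul_iff {X : Type*} [Finite X] [DecidableEq X]
    (f : Equiv.Perm X) {a b : X} (hab : a ≠ b) :
    (Equiv.swap a b * f).SameCycle a b ↔ ¬ f.SameCycle a b := by
  set g := Equiv.swap a b * f with hg
  have hex : ∃ N, 0 < N ∧ ((f ^ N) a = a ∨ (f ^ N) a = b) :=
    ⟨orderOf f, orderOf_pos f, Or.inl (by rw [pow_orderOf_eq_one]; rfl)⟩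
  classical
  -- the first return of the orbit of `a` to the two points
  obtain ⟨hN, hNab⟩ := Nat.find_spec hex
  have hmin (i : ℕ) (hi : 0 < i) (hiN : i < Nat.find hex) : (f ^ i) a ≠ a ∧ (f ^ i) a ≠ b := by
    have := Nat.find_min hex hiN
    tauto
  generalize Nat.find hex = N at hN hNab hmin
  have hpow (i : ℕ) (hi : i < N) : (g ^ i) a = (f ^ i) a := by
    induction i with
    | zero => rfl
    | succ i ih =>
      obtain ⟨h1, h2⟩ := hmin (i + 1) (by lia) hi
      rw [pow_succ', Equiv.Perm.mul_apply, ih (by lia), hg, Equiv.Perm.mul_apply,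
        ← Equiv.Perm.mul_apply f, ← pow_succ', Equiv.swap_apply_of_ne_of_ne h1 h2]
  have hpowN : (g ^ N) a = Equiv.swap a b ((f ^ N) a) := by
    obtain ⟨M, rfl⟩ : ∃ M, N = M + 1 := ⟨N - 1, by lia⟩
    rw [pow_succ', Equiv.Perm.mul_apply, hpow M (by lia), hg, Equiv.Perm.mul_apply,
      ← Equiv.Perm.mul_apply f, ← pow_succ']
  have hnot (k : Equiv.Perm X) (hk : ∀ i < N, (k ^ i) a = (f ^ i) a) (hkN : (k ^ N) a = a) :
      ¬ k.SameCycle a b := by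
    intro h
    obtain ⟨i, hi⟩ := h.exists_nat_pow_eq
    have h1 (q : ℕ) : ((k ^ N) ^ q) a = a := by
      induction q with
      | zero => rfl
      | succ q ih => rw [pow_succ, Equiv.Perm.mul_apply, hkN, ih]
    rw [← Nat.mod_add_div i N, pow_add, pow_mul, Equiv.Perm.mul_apply, h1,
      hk _ (Nat.mod_lt _ hN)] at hi
    rcases Nat.eq_zero_or_pos (i % N) with h0 | h0
    · rw [h0] at hi; exact hab hi
    · exact (hmin _ h0 (Nat.mod_lt _ hN)).2 hi
  rcases hNab with h | h
  · rw [h, Equiv.swap_apply_left] at hpowN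
    exact iff_of_true ⟨N, by rw [zpow_natCast, hpowN]⟩ (hnot f (fun _ _ => rfl) h)
  · rw [h, Equiv.swap_apply_right] at hpowN
    exact iff_of_false (hnot g hpow hpowN) (not_not.2 ⟨N, by rw [zpow_natCast, h]⟩)

namespace PlaneGraph

variable {G : PlaneGraph}

lemma circle_edge (α : G.Vertex → Bool) (x : G.Dart) :
    G.circle α (Sum.inl (G.edge x)) = G.circle α (Sum.inl x) :=
  (Quot.sound (Joined.edge x)).symm

lemma circle_vertex (α : G.Vertex → Bool) (v : G.Vertex) (i : Fin 4) :
    G.circle α (Sum.inl (v, smoothingPartner (α v) i)) = G.circle α (Sum.inl (v, i)) :=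
  (Quot.sound (Joined.vertex v i)).symm

/-- A piece of a circle. -/
def rep {α : G.Vertex → Bool} (C : G.Circle α) : G.Piece := Quot.out C

lemma circle_rep {α : G.Vertex → Bool} (C : G.Circle α) : G.circle α (rep C) = C :=
  Quot.out_eq C

/-- A relation that is respected by the generating joins is respected by lying on one circle. -/
lemma iff_of_circle_eq {α : G.Vertex → Bool} {P : G.Piece → Prop}
    (he : ∀ x : G.Dart, P (Sum.inl x) ↔ P (Sum.inl (G.edge x)))
    (hv : ∀ (v : G.Vertex) (i : Fin 4),
      P (Sum.inl (v, i)) ↔ P (Sum.inl (v, smoothingPartner (α v) i)))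
    {p q : G.Piece} (h : G.circle α p = G.circle α q) : P p ↔ P q := by
  have hP : ∀ p q, G.Joined α p q → P p = P q := by
    rintro _ _ (x | ⟨v, i⟩)
    · exact propext (he x)
    · exact propext (hv v i)
  exact iff_of_eq (congrArg (Quot.lift P hP) h)

lemma smoothingPartner_smoothingPartner (b : Bool) (i : Fin 4) :
    smoothingPartner b (smoothingPartner b i) = i := by
  revert b i; decide

/-- The involution that joins half-edges at the vertices in the smoothing `α`. -/
def partnerPerm (α : G.Vertex → Bool) : Equiv.Perm G.Dart :=
  Function.Involutive.toPerm (fun x => (x.1, smoothingPartner (α x.1) x.2)) fun x => by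
    simp [smoothingPartner_smoothingPartner]

lemma partnerPerm_apply (α : G.Vertex → Bool) (x : G.Dart) :
    partnerPerm α x = (x.1, smoothingPartner (α x.1) x.2) := rfl

lemma partnerPerm_partnerPerm (α : G.Vertex → Bool) (x : G.Dart) :
    partnerPerm α (partnerPerm α x) = x := by
  simp [partnerPerm_apply, smoothingPartner_smoothingPartner]

section Alternating

variable {dir : G.Dart → Bool} (hedge : ∀ x, dir (G.edge x) = !dir x)
  (halt : ∀ v i, dir (v, i + 1) = !dir (v, i))

include halt in
lemma dir_partnerPerm (α : G.Vertex → Bool) (x : G.Dart) :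
    dir (partnerPerm α x) = !dir x := by
  obtain ⟨v, i⟩ := x
  rw [partnerPerm_apply]
  have h0 : dir (v, 1) = !dir (v, 0) := halt v 0
  have h1 : dir (v, 2) = !dir (v, 1) := halt v 1
  have h2 : dir (v, 3) = !dir (v, 2) := halt v 2
  cases α v <;> fin_cases i <;> simp [smoothingPartner, h0, h1, h2]

/-- An alternating orientation runs consistently along the circles of any smoothing. This is
the permutation of the outgoing half-edges that follows the circles to the next one. -/
def nextOut (α : G.Vertex → Bool) : Equiv.Perm {x : G.Dart // dir x = true} :=
  (partnerPerm α * G.edge).subtypePerm fun x => by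
    rw [Equiv.Perm.mul_apply, dir_partnerPerm halt, hedge, Bool.not_not]

/-- The outgoing half-edge at the same passage of a circle through a vertex. -/
def outDart (α : G.Vertex → Bool) (x : G.Dart) : {x : G.Dart // dir x = true} :=
  if h : dir x = true then ⟨x, h⟩ else
    ⟨partnerPerm α x, by rw [dir_partnerPerm halt]; simpa using h⟩

lemma circle_outDart (α : G.Vertex → Bool) (x : G.Dart) :
    G.circle α (Sum.inl (outDart halt α x).1) = G.circle α (Sum.inl x) := by
  unfold outDart
  split_ifs
  · rfl
  · exact circle_vertex α x.1 x.2

/-- The circles that pass by vertices are the cycles of `nextOut`. -/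
lemma circle_eq_iff_sameCycle (α : G.Vertex → Bool) (x y : G.Dart) :
    G.circle α (Sum.inl x) = G.circle α (Sum.inl y) ↔
      (nextOut hedge halt α).SameCycle (outDart halt α x) (outDart halt α y) := by
  constructor
  · intro h
    have hrefl := Equiv.Perm.SameCycle.refl (nextOut hedge halt α) (outDart halt α x)
    refine (iff_of_circle_eq (P := fun p => Sum.elim (fun y => (nextOut hedge halt α).SameCycle
      (outDart halt α x) (outDart halt α y)) (fun _ => False) p) (fun y => ?_) (fun v i => ?_)
      h).1 hrefl
    · simp only [Sum.elim_inl]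
      by_cases hy : dir y = true
      · have : outDart halt α (G.edge y) = nextOut hedge halt α (outDart halt α y) := by
          have h' : ¬ dir (G.edge y) = true := by rw [hedge, hy]; decide
          rw [outDart, dif_neg h', outDart, dif_pos hy]
          rfl
        rw [this, Equiv.Perm.sameCycle_apply_right]
      · have : outDart halt α y = nextOut hedge halt α (outDart halt α (G.edge y)) := by
          have h' : dir (G.edge y) = true := by rw [hedge]; simpa using hy
          rw [outDart, dif_neg hy, outDart, dif_pos h']
          refine Subtype.ext ?_
          change _ = partnerPerm α (G.edge (G.edge y))
          rw [G.edge_edge]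
        rw [this, Equiv.Perm.sameCycle_apply_right]
    · simp only [Sum.elim_inl]
      have : outDart halt α (partnerPerm α (v, i)) = outDart halt α (v, i) := by
        have h' := dir_partnerPerm halt α (v, i)
        by_cases hy : dir (v, i) = true
        · have h'' : ¬ dir (partnerPerm α (v, i)) = true := by rw [h', hy]; decide
          rw [outDart, dif_neg h'', outDart, dif_pos hy]
          exact Subtype.ext (partnerPerm_partnerPerm α _)
        · have h'' : dir (partnerPerm α (v, i)) = true := by rw [h']; simpa using hy
          rw [outDart, dif_pos h'', outDart, dif_neg hy]
      rw [← this]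
      rfl
  · intro h
    rw [← circle_outDart halt, ← circle_outDart halt α y]
    refine h.map_eq_map (f := fun x => G.circle α (Sum.inl x.1)) fun x => ?_
    exact (circle_vertex α _ _).trans (circle_edge α x.1)

include hedge halt in
/-- Whether the two arcs at `v` lie on one circle depends on the smoothing of `v`. -/
lemma circle_eq_iff_not_of_alternating {α β : G.Vertex → Bool} {v : G.Vertex}
    (hv : α v ≠ β v) (hw : ∀ w, w ≠ v → α w = β w) :
    G.circle β (Sum.inl (v, 0)) = G.circle β (Sum.inl (v, 2)) ↔
      ¬ G.circle α (Sum.inl (v, 0)) = G.circle α (Sum.inl (v, 2)) := by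
  have h0 : dir (v, 1) = !dir (v, 0) := halt v 0
  have h1 : dir (v, 2) = !dir (v, 1) := halt v 1
  have h2 : dir (v, 3) = !dir (v, 2) := halt v 2
  have hne : outDart halt α (v, 0) ≠ outDart halt α (v, 2) := by
    intro h
    have h := congrArg (fun x => x.1.2) h
    simp only [outDart, partnerPerm_apply] at h
    cases hd : dir (v, 0) <;> cases hα : α v <;> simp [h1, h0, hd, hα, smoothingPartner] at h
  have hnext : nextOut hedge halt β =
      Equiv.swap (outDart halt α (v, 0)) (outDart halt α (v, 2)) * nextOut hedge halt α := by
    refine Equiv.ext fun ⟨x, hx⟩ => ?_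
    rw [Equiv.Perm.mul_apply]
    have hx' : dir (G.edge x) = false := by rw [hedge, hx]; rfl
    have hα : (nextOut hedge halt α ⟨x, hx⟩).1 = partnerPerm α (G.edge x) := rfl
    have hβ : (nextOut hedge halt β ⟨x, hx⟩).1 = partnerPerm β (G.edge x) := rfl
    generalize nextOut hedge halt α ⟨x, hx⟩ = y at hα
    generalize nextOut hedge halt β ⟨x, hx⟩ = z at hβ
    generalize G.edge x = e at *
    obtain ⟨w, i⟩ := e
    by_cases hwv : w = v
    · subst hwv
      obtain ⟨y, hy⟩ := y
      obtain ⟨z, hz⟩ := z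
      simp only at hα hβ
      subst hα hβ
      rw [Equiv.swap_apply_def]
      cases hd : dir (w, 0) <;> cases hα : α w <;> cases hβ : β w <;>
        first
        | exact absurd (hα.trans hβ.symm) hv
        | (fin_cases i <;> simp_all [outDart, partnerPerm_apply, smoothingPartner])
    · have h (j : Fin 4) : y ≠ outDart halt α (v, j) := by
        intro h
        have h := congrArg (fun x => x.1.1) h
        simp only [hα, partnerPerm_apply, outDart] at h
        split_ifs at h <;> exact hwv h
      rw [Equiv.swap_apply_of_ne_of_ne (h 0) (h 2)]
      refine Subtype.ext ?_
      rw [hα, hβ, partnerPerm_apply, partnerPerm_apply, hw w hwv]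
  classical
  rw [circle_eq_iff_sameCycle hedge halt, circle_eq_iff_sameCycle hedge halt α,
    ← Equiv.Perm.sameCycle_swap_mul_iff _ hne, hnext]
  have hout : (outDart halt β (v, 0) = outDart halt α (v, 0) ∧
      outDart halt β (v, 2) = outDart halt α (v, 2)) ∨
      (outDart halt β (v, 0) = outDart halt α (v, 2) ∧
      outDart halt β (v, 2) = outDart halt α (v, 0)) := by
    cases hd : dir (v, 0) <;> cases hα : α v <;> cases hβ : β v <;>
      first
      | exact absurd (hα.trans hβ.symm) hv
      | simp_all [outDart, partnerPerm_apply, smoothingPartner]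
  rcases hout with ⟨h, h'⟩ | ⟨h, h'⟩
  · rw [h, h']
  · rw [h, h', Equiv.Perm.sameCycle_comm]

end Alternating

/-- Planarity excludes that a change of smoothing turns one circle into one circle. -/
lemma circle_eq_iff_not {α β : G.Vertex → Bool} {v : G.Vertex}
    (hv : α v ≠ β v) (hw : ∀ w, w ≠ v → α w = β w) :
    G.circle β (Sum.inl (v, 0)) = G.circle β (Sum.inl (v, 2)) ↔
      ¬ G.circle α (Sum.inl (v, 0)) = G.circle α (Sum.inl (v, 2)) := by
  obtain ⟨dir, hedge, halt⟩ := G.exists_alternating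
  exact circle_eq_iff_not_of_alternating hedge halt hv hw

/-- The circle of `α` through `p` passes by the vertex `v`. -/
def PassesBy (α : G.Vertex → Bool) (v : G.Vertex) (p : G.Piece) : Prop :=
  G.circle α p = G.circle α (Sum.inl (v, 0)) ∨ G.circle α p = G.circle α (Sum.inl (v, 2))

lemma passesBy_self (α : G.Vertex → Bool) (v : G.Vertex) (i : Fin 4) :
    PassesBy α v (Sum.inl (v, i)) := by
  have h0 := circle_vertex α v 0
  have h2 := circle_vertex α v 2
  unfold PassesBy
  cases hα : α v <;> simp only [hα, smoothingPartner] at h0 h2 <;> fin_cases i <;> simp_all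

/-- The circles of `β` arise from those of `α` by merging the two circles that pass by `v`. -/
structure Merges (α β : G.Vertex → Bool) (v : G.Vertex) : Prop where
  mono : ∀ {p q}, G.circle α p = G.circle α q → G.circle β p = G.circle β q
  eq_or : ∀ {p q}, G.circle β p = G.circle β q →
    G.circle α p = G.circle α q ∨ PassesBy α v p ∧ PassesBy α v q
  ne : G.circle α (Sum.inl (v, 0)) ≠ G.circle α (Sum.inl (v, 2))
  eq : G.circle β (Sum.inl (v, 0)) = G.circle β (Sum.inl (v, 2))

lemma merges_of_ne {α β : G.Vertex → Bool} {v : G.Vertex} (hv : α v ≠ β v)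
    (hw : ∀ w, w ≠ v → α w = β w)
    (h : G.circle α (Sum.inl (v, 0)) ≠ G.circle α (Sum.inl (v, 2))) : Merges α β v := by
  have heq := (circle_eq_iff_not hv hw).2 h
  have hβ (i : Fin 4) : G.circle β (Sum.inl (v, i)) = G.circle β (Sum.inl (v, 0)) :=
    (passesBy_self β v i).elim id fun h => h.trans heq.symm
  refine ⟨fun {p q} hpq => ?_, fun {p q} hpq => ?_, h, heq⟩
  · refine (iff_of_circle_eq (P := fun r => G.circle β p = G.circle β r)
      (fun x => by rw [circle_edge]) (fun w i => ?_) hpq).1 rfl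
    by_cases hwv : w = v
    · subst hwv
      rw [hβ i, hβ (smoothingPartner (α w) i)]
    · rw [hw w hwv, circle_vertex]
  · refine (iff_of_circle_eq (P := fun r => G.circle α p = G.circle α r ∨
      PassesBy α v p ∧ PassesBy α v r) (fun x => ?_) (fun w i => ?_) hpq).1 (Or.inl rfl)
    · simp only [PassesBy, circle_edge]
    · by_cases hwv : w = v
      · subst hwv
        have h (i : Fin 4) : (G.circle α p = G.circle α (Sum.inl (w, i)) ∨
            PassesBy α w p ∧ PassesBy α w (Sum.inl (w, i))) ↔ PassesBy α w p := by
          constructor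
          · rintro (h | h)
            · have := passesBy_self α w i
              rwa [PassesBy, ← h] at this
            · exact h.1
          · exact fun h => Or.inr ⟨h, passesBy_self α w i⟩
        rw [h, h]
      · rw [← hw w hwv]
        simp only [PassesBy, circle_vertex]

/-- A change of the smoothing of one vertex merges two circles or splits one. -/
lemma merges_or_merges {α β : G.Vertex → Bool} {v : G.Vertex} (hv : α v ≠ β v)
    (hw : ∀ w, w ≠ v → α w = β w) : Merges α β v ∨ Merges β α v := by
  by_cases h : G.circle α (Sum.inl (v, 0)) = G.circle α (Sum.inl (v, 2))
  · refine Or.inr (merges_of_ne hv.symm (fun w hwv => (hw w hwv).symm) fun h' => ?_)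
    exact (circle_eq_iff_not hv hw).1 h' h
  · exact Or.inl (merges_of_ne hv hw h)

namespace Merges

variable {α β : G.Vertex → Bool} {v : G.Vertex} (H : Merges α β v)
include H

lemma passesBy_left_iff {p : G.Piece} :
    PassesBy α v p ↔ G.circle β p = G.circle β (Sum.inl (v, 0)) := by
  constructor
  · rintro (h | h)
    · exact H.mono h
    · exact (H.mono h).trans H.eq.symm
  · intro h
    exact (H.eq_or h).elim Or.inl And.left

lemma passesBy_right_iff {p : G.Piece} :
    PassesBy β v p ↔ G.circle β p = G.circle β (Sum.inl (v, 0)) := by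
  rw [PassesBy, ← H.eq, or_self]

lemma eq_iff_of_not_passesBy {p q : G.Piece} (hp : ¬ PassesBy α v p) :
    G.circle β p = G.circle β q ↔ G.circle α p = G.circle α q :=
  ⟨fun h => (H.eq_or h).elim id fun h => absurd h.1 hp, H.mono⟩

/-- Sums over the circles before and after a merger differ by the terms of the circles that
pass by `v`. -/
lemma sum_add {M : Type*} [AddCommMonoid M] (a : G.Circle α → M) (b : G.Circle β → M)
    (hab : ∀ p, ¬ PassesBy α v p → a (G.circle α p) = b (G.circle β p)) :
    (∑ C, a C) + b (G.circle β (Sum.inl (v, 0))) =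
      (∑ C, b C) + (a (G.circle α (Sum.inl (v, 0))) + a (G.circle α (Sum.inl (v, 2)))) := by
  classical
  have hmem {C : G.Circle α} (hC : C ∈ Finset.univ \
      {G.circle α (Sum.inl (v, 0)), G.circle α (Sum.inl (v, 2))}) : ¬ PassesBy α v (rep C) := by
    simpa [PassesBy, circle_rep] using hC
  have h : ∑ C ∈ Finset.univ \ {G.circle α (Sum.inl (v, 0)), G.circle α (Sum.inl (v, 2))}, a C =
      ∑ C ∈ Finset.univ \ {G.circle β (Sum.inl (v, 0))}, b C := by
    refine Finset.sum_bij (fun C _ => G.circle β (rep C)) ?_ ?_ ?_ ?_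
    · intro C hC
      have hC' := hmem hC
      simp only [Finset.mem_sdiff, Finset.mem_univ, true_and, Finset.mem_singleton]
      exact fun h => hC' (H.passesBy_left_iff.2 h)
    · intro C hC C' _ h
      rw [← circle_rep C, ← circle_rep C']
      exact (H.eq_iff_of_not_passesBy (hmem hC)).1 h
    · intro C hC
      simp only [Finset.mem_sdiff, Finset.mem_univ, true_and, Finset.mem_singleton] at hC
      rw [← circle_rep C] at hC
      refine ⟨G.circle α (rep C), ?_, (H.mono (circle_rep _)).trans (circle_rep C)⟩
      simp only [Finset.mem_sdiff, Finset.mem_univ, true_and, Finset.mem_insert,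
        Finset.mem_singleton]
      exact fun h => hC (H.passesBy_left_iff.1 h)
    · intro C hC
      rw [← hab _ (hmem hC), circle_rep]
  rw [← Finset.sum_sdiff (Finset.subset_univ
      {G.circle α (Sum.inl (v, 0)), G.circle α (Sum.inl (v, 2))}), h, Finset.sum_pair H.ne,
    ← Finset.sum_sdiff (s₂ := Finset.univ)
      (Finset.subset_univ {G.circle β (Sum.inl (v, 0))}), Finset.sum_singleton]
  abel

lemma card_circle : Fintype.card (G.Circle α) = Fintype.card (G.Circle β) + 1 := by
  have := H.sum_add (fun _ => 1) (fun _ => 1) (fun _ _ => rfl)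
  simpa using this

end Merges

end PlaneGraph

/-! ### A model of the modules `V_α` by polynomials -/

/-- The exponent of `x` in a basis element of `V`. -/
def Gen.exponent : Gen → ℕ
  | one => 0
  | x => 1

lemma Gen.exponent_injective : Function.Injective Gen.exponent := by
  rintro (_ | _) (_ | _) h <;> first | rfl | cases h

lemma Gen.exponent_le_one (a : Gen) : a.exponent ≤ 1 := by
  cases a <;> decide

namespace PlaneGraph

variable {G : PlaneGraph}

open MvPolynomial

/-- The ideal of `ℤ[Piece]` with the quotient `V_α = ⨂ ℤ[x] / (x ^ 2)`, the tensor product over the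
circles of `α`: a piece is sent to the generator `x` of the factor of its circle. -/
def circleIdeal (α : G.Vertex → Bool) : Ideal (MvPolynomial G.Piece ℤ) :=
  Ideal.span ((Set.range fun p => X p ^ 2) ∪
    {f | ∃ p q, G.circle α p = G.circle α q ∧ f = X p - X q})

lemma X_sq_mem_circleIdeal (α : G.Vertex → Bool) (p : G.Piece) :
    (X p ^ 2 : MvPolynomial G.Piece ℤ) ∈ circleIdeal α :=
  Ideal.subset_span (Or.inl ⟨p, rfl⟩)

lemma X_sub_X_mem_circleIdeal {α : G.Vertex → Bool} {p q : G.Piece}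
    (h : G.circle α p = G.circle α q) :
    (X p - X q : MvPolynomial G.Piece ℤ) ∈ circleIdeal α :=
  Ideal.subset_span (Or.inr ⟨p, q, h, rfl⟩)

instance (α : G.Vertex → Bool) : Fintype (G.Circle α → Gen) := Fintype.ofFinite _

section Labels

variable {α : G.Vertex → Bool} (l : G.Circle α → Gen)

/-- The exponent of the squarefree monomial of a labelling of the circles. -/
def labelExponent : G.Circle α →₀ ℕ :=
  Finsupp.equivFunOnFinite.symm fun C => (l C).exponent

lemma labelExponent_apply (C : G.Circle α) : labelExponent l C = (l C).exponent := rfl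

lemma labelExponent_injective :
    Function.Injective (labelExponent : (G.Circle α → Gen) → G.Circle α →₀ ℕ) :=
  fun _ _ h => funext fun C => Gen.exponent_injective (DFunLike.congr_fun h C)

/-- A representative of the basis element of `V_α` that is given by a labelling. -/
def labelMonomial : MvPolynomial G.Piece ℤ :=
  monomial ((labelExponent l).mapDomain rep) 1

/-- The coordinate of (the class of) a polynomial with respect to the basis element of
`V_α` that is given by a labelling. -/
def labelCoeff : MvPolynomial G.Piece ℤ →ₗ[ℤ] ℤ :=
  (lcoeff ℤ (labelExponent l)).comp (rename (G.circle α)).toLinearMap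

lemma labelCoeff_apply (f : MvPolynomial G.Piece ℤ) :
    labelCoeff l f = coeff (labelExponent l) (rename (G.circle α) f) := rfl

open Classical in
lemma labelCoeff_monomial (e : G.Piece →₀ ℕ) (a : ℤ) :
    labelCoeff l (monomial e a) =
      if e.mapDomain (G.circle α) = labelExponent l then a else 0 := by
  rw [labelCoeff_apply, rename_monomial, coeff_monomial]

lemma mapDomain_mapDomain_rep (e : G.Circle α →₀ ℕ) :
    (e.mapDomain rep).mapDomain (G.circle α) = e := by
  rw [← Finsupp.mapDomain_comp]
  exact (congrArg (Finsupp.mapDomain · e) (funext circle_rep)).trans Finsupp.mapDomain_id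

lemma labelCoeff_eq_zero_of_mem {f : MvPolynomial G.Piece ℤ} (hf : f ∈ circleIdeal α) :
    labelCoeff l f = 0 := by
  have h : circleIdeal α ≤ (Ideal.span ((fun e => monomial e (1 : ℤ)) ''
      Set.range fun C : G.Circle α => Finsupp.single C 2)).comap (rename (G.circle α)) := by
    refine Ideal.span_le.2 ?_
    rintro _ (⟨p, rfl⟩ | ⟨p, q, h, rfl⟩)
    · change rename (G.circle α) ((X p : MvPolynomial G.Piece ℤ) ^ 2) ∈ Ideal.span _
      rw [map_pow, rename_X, X_pow_eq_monomial]
      exact Ideal.subset_span ⟨_, ⟨_, rfl⟩, rfl⟩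
    · change rename (G.circle α) (X p - X q : MvPolynomial G.Piece ℤ) ∈ Ideal.span _
      rw [map_sub, rename_X, rename_X, h, sub_self]
      exact zero_mem _
  have h1 := h hf
  rw [Ideal.mem_comap, mem_ideal_span_monomial_image] at h1
  by_contra h2
  obtain ⟨_, ⟨C, rfl⟩, hC⟩ := h1 (labelExponent l) (mem_support_iff.2 h2)
  have h3 := hC C
  rw [Finsupp.single_eq_same, labelExponent_apply] at h3
  have := (l C).exponent_le_one
  lia

end Labels

/-- The class of a polynomial in the pieces depends only on its image as a polynomial
in the circles. -/
lemma mk_circleIdeal_eq (α : G.Vertex → Bool) (f : MvPolynomial G.Piece ℤ) :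
    Ideal.Quotient.mk (circleIdeal α) f =
      aeval (fun C => Ideal.Quotient.mk (circleIdeal α) (X (rep C)))
        (rename (G.circle α) f) := by
  have : (Ideal.Quotient.mkₐ ℤ (circleIdeal α)) =
      (aeval (fun C => Ideal.Quotient.mk (circleIdeal α) (X (rep C)))).comp
        (rename (G.circle α)) := by
    refine MvPolynomial.algHom_ext fun p => ?_
    rw [AlgHom.comp_apply, rename_X, aeval_X]
    exact (Ideal.Quotient.eq.2 (X_sub_X_mem_circleIdeal (circle_rep _).symm))
  exact DFunLike.congr_fun this f

/-- Modulo the ideal, a polynomial is the combination of the basis elements with its coordinates. -/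
lemma sub_sum_labelCoeff_mem (α : G.Vertex → Bool)
    (f : MvPolynomial G.Piece ℤ) :
    f - ∑ l : G.Circle α → Gen, labelCoeff l f • labelMonomial l ∈ circleIdeal α := by
  classical
  induction f using MvPolynomial.induction_on' with
  | add f g hf hg =>
    simp only [map_add, add_smul, Finset.sum_add_distrib]
    rw [add_sub_add_comm]
    exact add_mem hf hg
  | monomial e a =>
    by_cases h : ∃ C, 2 ≤ (e.mapDomain (G.circle α)) C
    · obtain ⟨C, hC⟩ := h
      rw [Finset.sum_eq_zero, sub_zero]
      · rw [← Ideal.Quotient.eq_zero_iff_mem, mk_circleIdeal_eq, rename_monomial, aeval_monomial]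
        refine mul_eq_zero_of_right _ ?_
        rw [Finsupp.prod_fintype _ _ fun _ => pow_zero _]
        refine Finset.prod_eq_zero (Finset.mem_univ C) ?_
        rw [← map_pow, Ideal.Quotient.eq_zero_iff_mem]
        exact Ideal.mem_of_dvd _ (pow_dvd_pow _ hC) (X_sq_mem_circleIdeal α _)
      · intro l _
        rw [labelCoeff_monomial, if_neg, zero_smul]
        intro h
        rw [h, labelExponent_apply] at hC
        have := (l C).exponent_le_one
        lia
    · push Not at h
      let l : G.Circle α → Gen := fun C =>
        if (e.mapDomain (G.circle α)) C = 0 then Gen.one else Gen.x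
      have hl : e.mapDomain (G.circle α) = labelExponent l := by
        ext C
        rw [labelExponent_apply]
        have := h C
        by_cases h0 : (e.mapDomain (G.circle α)) C = 0
        · simp only [l, if_pos h0]; exact h0
        · simp only [l, if_neg h0]
          change _ = 1
          lia
      rw [Finset.sum_eq_single l]
      · rw [labelCoeff_monomial, if_pos hl, ← Ideal.Quotient.eq, mk_circleIdeal_eq,
          mk_circleIdeal_eq α (_ • _), rename_monomial, hl, map_smul, labelMonomial,
          rename_monomial, mapDomain_mapDomain_rep, smul_monomial, smul_eq_mul, mul_one]
      · intro l' _ hl'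
        rw [labelCoeff_monomial, if_neg, zero_smul]
        intro h'
        exact hl' (labelExponent_injective (h'.symm.trans hl))
      · exact fun h => absurd (Finset.mem_univ _) h

open Classical in
/-- A lift to polynomials of the map of the edge of the cube at which the smoothing `α` changes
at `v` is the multiplication by this polynomial: a merger is induced by the identity, and the
coproduct is `f ↦ f (x ⊗ 1 + 1 ⊗ x)`. -/
def edgeFactor (α : G.Vertex → Bool) (v : G.Vertex) : MvPolynomial G.Piece ℤ :=
  if G.circle α (Sum.inl (v, 0)) = G.circle α (Sum.inl (v, 2)) then
    X (Sum.inl (v, 0)) + X (Sum.inl (v, 2)) else 1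

lemma Merges.edgeFactor_left {α β : G.Vertex → Bool} {v : G.Vertex} (H : Merges α β v) :
    edgeFactor α v = 1 := if_neg H.ne

lemma Merges.edgeFactor_right {α β : G.Vertex → Bool} {v : G.Vertex} (H : Merges α β v) :
    edgeFactor β v = X (Sum.inl (v, 0)) + X (Sum.inl (v, 2)) := if_pos H.eq

/-- The multiplication by `edgeFactor` is well-defined on the modules `V_α`. -/
lemma mul_edgeFactor_mem {α β : G.Vertex → Bool} {v : G.Vertex} (hv : α v ≠ β v)
    (hw : ∀ w, w ≠ v → α w = β w) {f : MvPolynomial G.Piece ℤ} (hf : f ∈ circleIdeal α) :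
    f * edgeFactor α v ∈ circleIdeal β := by
  have h : circleIdeal α ≤ Submodule.comap
      (LinearMap.mulRight (MvPolynomial G.Piece ℤ) (edgeFactor α v)) (circleIdeal β) := by
    refine Ideal.span_le.2 ?_
    rintro _ (⟨p, rfl⟩ | ⟨p, q, h, rfl⟩)
    · change X p ^ 2 * edgeFactor α v ∈ circleIdeal β
      exact Ideal.mul_mem_right _ _ (X_sq_mem_circleIdeal β p)
    · change (X p - X q) * edgeFactor α v ∈ circleIdeal β
      rcases merges_or_merges hv hw with H | H
      · exact Ideal.mul_mem_right _ _ (X_sub_X_mem_circleIdeal (H.mono h))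
      · rw [H.edgeFactor_right]
        by_cases hpq : G.circle β p = G.circle β q
        · exact Ideal.mul_mem_right _ _ (X_sub_X_mem_circleIdeal hpq)
        -- `p`, `q` lie on the two circles that arise by the split, and the product of
        -- `x ⊗ 1 - 1 ⊗ x` and `x ⊗ 1 + 1 ⊗ x` is zero
        have hsq (r r' : G.Piece) : (X r - X r') * (X r + X r') ∈ circleIdeal β := by
          have : (X r - X r') * (X r + X r') = (X r ^ 2 - X r' ^ 2 : MvPolynomial G.Piece ℤ) := by
            ring
          rw [this]
          exact sub_mem (X_sq_mem_circleIdeal β r) (X_sq_mem_circleIdeal β r')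
        have hkey : ∀ r r' : G.Piece, G.circle β p = G.circle β r → G.circle β q = G.circle β r' →
            (X p - X q) * (X r + X r') ∈ circleIdeal β := by
          intro r r' hr hr'
          have h1 := Ideal.mul_mem_right (X r + X r') _ (X_sub_X_mem_circleIdeal hr)
          have h2 := Ideal.mul_mem_right (X r + X r') _ (X_sub_X_mem_circleIdeal hr')
          have h3 := add_mem (sub_mem h1 h2) (hsq r r')
          convert! h3 using 1
          ring
        obtain ⟨hp | hp, hq | hq⟩ := (H.eq_or h).resolve_left hpq
        · exact absurd (hp.trans hq.symm) hpq
        · exact hkey _ _ hp hq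
        · rw [add_comm]
          exact hkey _ _ hp hq
        · exact absurd (hp.trans hq.symm) hpq
  exact h hf

end PlaneGraph

namespace PlaneGraph

variable {G : PlaneGraph}

open MvPolynomial

/-- The two ways around a square of the cube agree on the modules `V_α`. -/
lemma edgeFactor_mul_sub_mem {α : G.Vertex → Bool} {v w : G.Vertex} (hvw : v ≠ w)
    (hv : α v = false) (hw : α w = false) :
    edgeFactor α v * edgeFactor (Function.update α v true) w -
      edgeFactor α w * edgeFactor (Function.update α w true) v ∈
        circleIdeal (Function.update (Function.update α v true) w true) := by
  set β := Function.update α v true with hβ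
  set γ := Function.update α w true with hγ
  set δ := Function.update β w true with hδ
  have H1 : Merges α β v ∨ Merges β α v := by
    refine merges_or_merges (by simp [hβ, hv]) fun u hu => by simp [hβ, hu]
  have H2 : Merges α γ w ∨ Merges γ α w := by
    refine merges_or_merges (by simp [hγ, hw]) fun u hu => by simp [hγ, hu]
  have H3 : Merges β δ w ∨ Merges δ β w := by
    refine merges_or_merges (by simp [hδ, hβ, hvw.symm, hw]) fun u hu => by simp [hδ, hu]
  have hδ' : δ = Function.update γ v true := Function.update_comm hvw _ _ _
  have H4 : Merges γ δ v ∨ Merges δ γ v := by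
    refine merges_or_merges (by simp [hδ', hγ, hvw, hv]) fun u hu => by simp [hδ', hu]
  clear_value β γ δ
  have key (p q r t : G.Piece) (h1 : G.circle δ p = G.circle δ r)
      (h2 : G.circle δ q = G.circle δ t) :
      (X p + X q : MvPolynomial G.Piece ℤ) - (X r + X t) ∈ circleIdeal δ := by
    rw [add_sub_add_comm]
    exact add_mem (X_sub_X_mem_circleIdeal h1) (X_sub_X_mem_circleIdeal h2)
  -- The numbers of circles show that both ways contain equally many splits. So the two products
  -- can differ only if each way contains one split and these are at different vertices. Then
  -- the variables of the two factors belong to the same circles of `δ`.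
  rcases H1 with H1 | H1 <;> rcases H2 with H2 | H2 <;> rcases H3 with H3 | H3 <;>
    rcases H4 with H4 | H4 <;>
    have c1 := H1.card_circle <;> have c2 := H2.card_circle <;> have c3 := H3.card_circle <;>
    have c4 := H4.card_circle <;> (try (exfalso; lia)) <;>
    simp only [H1.edgeFactor_left, H1.edgeFactor_right, H2.edgeFactor_left,
      H2.edgeFactor_right, H3.edgeFactor_left, H3.edgeFactor_right, H4.edgeFactor_left,
      H4.edgeFactor_right, one_mul, mul_one, sub_self, zero_mem]
  · have hw0 := ((H1.eq_or H3.eq).resolve_left H2.ne).1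
    have hv0 := H3.passesBy_left_iff.2 (H1.passesBy_left_iff.1 hw0).symm
    have hv2 := H3.passesBy_left_iff.2 (H1.eq.symm.trans (H1.passesBy_left_iff.1 hw0).symm)
    rcases hv0 with hv0 | hv0 <;> rcases hv2 with hv2 | hv2
    · exact absurd (hv0.trans hv2.symm) H4.ne
    · exact key _ _ _ _ hv0.symm hv2.symm
    · rw [add_comm (X (Sum.inl (w, 0)))]
      exact key _ _ _ _ hv0.symm hv2.symm
    · exact absurd (hv0.trans hv2.symm) H4.ne
  · obtain ⟨hw0 | hw0, hw2 | hw2⟩ := (H1.eq_or H2.eq).resolve_left H3.ne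
    · exact absurd (hw0.trans hw2.symm) H3.ne
    · exact key _ _ _ _ (H3.mono hw0.symm) (H3.mono hw2.symm)
    · rw [add_comm (X (Sum.inl (w, 0)))]
      exact key _ _ _ _ (H3.mono hw2.symm) (H3.mono hw0.symm)
    · exact absurd (hw0.trans hw2.symm) H3.ne
  · rw [mul_comm, sub_self]
    exact zero_mem _

open Classical in
lemma mapDomain_rep_apply {α : G.Vertex → Bool} (β : G.Vertex → Bool) (l : G.Circle α → Gen)
    (D : G.Circle β) :
    (((labelExponent l).mapDomain rep).mapDomain (G.circle β)) D =
      ∑ C : G.Circle α, if G.circle β (rep C) = D then (l C).exponent else 0 := by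
  rw [← Finsupp.mapDomain_comp, Finsupp.mapDomain, Finsupp.sum_apply, Finsupp.sum_fintype]
  · simp [Finsupp.single_apply, labelExponent_apply]
  · simp

namespace Merges

variable {α β : G.Vertex → Bool} {v : G.Vertex} (H : Merges α β v)
include H

/-- In a merger, the labels away from `v` keep their places, and those of the two circles that
pass by `v` are multiplied. -/
lemma mapDomain_eq_iff (l : G.Circle α → Gen) (t : G.Circle β → Gen) :
    ((labelExponent l).mapDomain rep).mapDomain (G.circle β) = labelExponent t ↔
      (∀ p, ¬ PassesBy α v p → l (G.circle α p) = t (G.circle β p)) ∧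
        (l (G.circle α (Sum.inl (v, 0)))).exponent + (l (G.circle α (Sum.inl (v, 2)))).exponent =
          (t (G.circle β (Sum.inl (v, 0)))).exponent := by
  classical
  have hoff (p : G.Piece) (hp : ¬ PassesBy α v p) :
      (((labelExponent l).mapDomain rep).mapDomain (G.circle β)) (G.circle β p) =
        (l (G.circle α p)).exponent := by
    rw [mapDomain_rep_apply, Finset.sum_eq_single (G.circle α p)]
    · rw [if_pos (H.mono (circle_rep _))]
    · intro C _ hC
      rw [if_neg fun h => hC ?_]
      rw [← circle_rep C]
      exact ((H.eq_iff_of_not_passesBy hp).1 h.symm).symm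
    · exact fun h => absurd (Finset.mem_univ _) h
  have hon : (((labelExponent l).mapDomain rep).mapDomain (G.circle β))
      (G.circle β (Sum.inl (v, 0))) =
        (l (G.circle α (Sum.inl (v, 0)))).exponent +
          (l (G.circle α (Sum.inl (v, 2)))).exponent := by
    rw [mapDomain_rep_apply, ← Finset.sum_filter, ← Finset.sum_pair
      (f := fun C => (l C).exponent) H.ne]
    congr 1
    ext C
    rw [Finset.mem_filter, ← H.passesBy_left_iff, PassesBy, circle_rep]
    simp
  constructor
  · intro h
    refine ⟨fun p hp => Gen.exponent_injective ?_, ?_⟩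
    · rw [← hoff p hp, h]; rfl
    · rw [← hon, h]; rfl
  · rintro ⟨h1, h2⟩
    ext D
    obtain ⟨p, rfl⟩ : ∃ p, G.circle β p = D := ⟨_, circle_rep D⟩
    by_cases hp : PassesBy α v p
    · rw [H.passesBy_left_iff.1 hp, hon, h2]; rfl
    · rw [hoff p hp, h1 p hp]; rfl

/-- In a split, the labels keep their places, and the label of the circle that is split goes to
one of the two new circles. -/
lemma exists_mapDomain_add_eq_iff (l : G.Circle β → Gen) : ∃ δ₀ δ₂ : ℕ,
    (δ₀ = 0 ∧ δ₂ = 1 ∨ δ₀ = 1 ∧ δ₂ = 0) ∧ ∀ (t : G.Circle α → Gen) (ε₀ ε₂ : ℕ),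
    (((labelExponent l).mapDomain rep).mapDomain (G.circle α) +
      (Finsupp.single (G.circle α (Sum.inl (v, 0))) ε₀ +
        Finsupp.single (G.circle α (Sum.inl (v, 2))) ε₂)) = labelExponent t ↔
      (∀ p, ¬ PassesBy α v p → l (G.circle β p) = t (G.circle α p)) ∧
        δ₀ * (l (G.circle β (Sum.inl (v, 0)))).exponent + ε₀ =
          (t (G.circle α (Sum.inl (v, 0)))).exponent ∧
        δ₂ * (l (G.circle β (Sum.inl (v, 0)))).exponent + ε₂ =
          (t (G.circle α (Sum.inl (v, 2)))).exponent := by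
  classical
  have hoff (p : G.Piece) (hp : ¬ PassesBy α v p) :
      (((labelExponent l).mapDomain rep).mapDomain (G.circle α)) (G.circle α p) =
        (l (G.circle β p)).exponent := by
    rw [mapDomain_rep_apply, Finset.sum_eq_single (G.circle β p)]
    · rw [if_pos]
      exact ((H.eq_iff_of_not_passesBy hp).1 (circle_rep _).symm).symm
    · intro C _ hC
      rw [if_neg fun h => hC ?_]
      rw [← circle_rep C]
      exact H.mono h
    · exact fun h => absurd (Finset.mem_univ _) h
  have hon (q : G.Piece) (hq : G.circle β q = G.circle β (Sum.inl (v, 0))) :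
      (((labelExponent l).mapDomain rep).mapDomain (G.circle α)) (G.circle α q) =
        if G.circle α (rep (G.circle β (Sum.inl (v, 0)))) = G.circle α q then
          (l (G.circle β (Sum.inl (v, 0)))).exponent else 0 := by
    rw [mapDomain_rep_apply, Finset.sum_eq_single (G.circle β (Sum.inl (v, 0)))]
    · intro C _ hC
      rw [if_neg fun h => hC ?_]
      rw [← circle_rep C]
      exact (H.mono h).trans hq
    · exact fun h => absurd (Finset.mem_univ _) h
  have hrep : PassesBy α v (rep (G.circle β (Sum.inl (v, 0)))) :=
    H.passesBy_left_iff.2 (circle_rep _)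
  refine ⟨if G.circle α (rep (G.circle β (Sum.inl (v, 0)))) = G.circle α (Sum.inl (v, 0))
    then 1 else 0, if G.circle α (rep (G.circle β (Sum.inl (v, 0)))) = G.circle α (Sum.inl (v, 2))
    then 1 else 0, ?_, fun t ε₀ ε₂ => ?_⟩
  · rcases hrep with h | h
    · rw [if_pos h, if_neg fun h' => H.ne (h.symm.trans h')]; simp
    · rw [if_pos h, if_neg fun h' => H.ne (h'.symm.trans h)]; simp
  have h0 := hon _ rfl
  have h2 := hon _ H.eq.symm
  simp only [ite_mul, one_mul, zero_mul]
  rw [← h0, ← h2]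
  have hs (p : G.Piece) (hp : ¬ PassesBy α v p) :
      (Finsupp.single (G.circle α (Sum.inl (v, 0))) ε₀ +
        Finsupp.single (G.circle α (Sum.inl (v, 2))) ε₂) (G.circle α p) = 0 := by
    rw [PassesBy, not_or] at hp
    rw [Finsupp.add_apply, Finsupp.single_eq_of_ne hp.1, Finsupp.single_eq_of_ne hp.2, add_zero]
  have hs0 : (Finsupp.single (G.circle α (Sum.inl (v, 0))) ε₀ +
        Finsupp.single (G.circle α (Sum.inl (v, 2))) ε₂) (G.circle α (Sum.inl (v, 0))) = ε₀ := by
    rw [Finsupp.add_apply, Finsupp.single_eq_same, Finsupp.single_eq_of_ne H.ne, add_zero]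
  have hs2 : (Finsupp.single (G.circle α (Sum.inl (v, 0))) ε₀ +
        Finsupp.single (G.circle α (Sum.inl (v, 2))) ε₂) (G.circle α (Sum.inl (v, 2))) = ε₂ := by
    rw [Finsupp.add_apply, Finsupp.single_eq_same, Finsupp.single_eq_of_ne H.ne.symm, zero_add]
  constructor
  · intro h
    refine ⟨fun p hp => Gen.exponent_injective ?_, ?_, ?_⟩
    · rw [← hoff p hp, ← labelExponent_apply t, ← h, Finsupp.add_apply, hs p hp, add_zero]
    · rw [← labelExponent_apply t, ← h, Finsupp.add_apply, hs0]
    · rw [← labelExponent_apply t, ← h, Finsupp.add_apply, hs2]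
  · rintro ⟨h1, h2, h3⟩
    ext D
    obtain ⟨p, rfl⟩ : ∃ p, G.circle α p = D := ⟨_, circle_rep D⟩
    rw [Finsupp.add_apply, labelExponent_apply]
    by_cases hp : PassesBy α v p
    · rcases hp with hp | hp
      · rw [hp, hs0, h2]
      · rw [hp, hs2, h3]
    · rw [hoff p hp, hs p hp, h1 p hp, add_zero]

end Merges

end PlaneGraph

namespace EnhancedState

variable {G : PlaneGraph} {D : LinkDiagram G}

open PlaneGraph MvPolynomial

/-- The coefficients of the maps of the edges of the cube in terms of polynomials. -/
lemma localCoeff_eq_labelCoeff {v : G.Vertex} {S T : EnhancedState D} (hv : S.α v ≠ T.α v)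
    (hw : ∀ w, w ≠ v → S.α w = T.α w) :
    localCoeff v S T = labelCoeff T.label (labelMonomial S.label * edgeFactor S.α v) := by
  classical
  have hpass : (∀ p : G.Piece, G.circle S.α p ≠ G.circle S.α (Sum.inl (v, 0)) →
      G.circle S.α p ≠ G.circle S.α (Sum.inl (v, 2)) → S.labelAt p = T.labelAt p) ↔
      ∀ p, ¬ PassesBy S.α v p → S.label (G.circle S.α p) = T.label (G.circle T.α p) := by
    simp only [PassesBy, not_or, and_imp]
    rfl
  rw [localCoeff, if_congr hpass rfl rfl]
  rcases merges_or_merges hv hw with H | H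
  · rw [H.edgeFactor_left, mul_one, labelMonomial, labelCoeff_monomial, if_pos H.ne,
      if_congr (H.mapDomain_eq_iff S.label T.label) rfl rfl]
    by_cases h : ∀ p, ¬ PassesBy S.α v p → S.label (G.circle S.α p) = T.label (G.circle T.α p)
    · rw [if_pos h, if_congr (and_iff_right h) rfl rfl]
      unfold labelAt
      generalize S.label (G.circle S.α (Sum.inl (v, 0))) = a
      generalize S.label (G.circle S.α (Sum.inl (v, 2))) = b
      generalize T.label (G.circle T.α (Sum.inl (v, 0))) = c
      cases a <;> cases b <;> cases c <;> rfl
    · rw [if_neg h, if_neg fun h' => h h'.1]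
  · rw [H.edgeFactor_right, mul_add, map_add, labelMonomial, if_neg (not_not.2 H.eq),
      if_pos H.ne, X, X, monomial_mul, monomial_mul, labelCoeff_monomial, labelCoeff_monomial,
      Finsupp.mapDomain_add, Finsupp.mapDomain_add, Finsupp.mapDomain_single,
      Finsupp.mapDomain_single]
    obtain ⟨δ₀, δ₂, hδ, hiff⟩ := H.exists_mapDomain_add_eq_iff S.label
    have h0 := hiff T.label 1 0
    have h2 := hiff T.label 0 1
    rw [Finsupp.single_zero, add_zero] at h0
    rw [Finsupp.single_zero, zero_add] at h2
    rw [if_congr h0 rfl rfl, if_congr h2 rfl rfl]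
    have hpass' : (∀ p, ¬ PassesBy S.α v p →
        S.label (G.circle S.α p) = T.label (G.circle T.α p)) ↔
        ∀ p, ¬ PassesBy T.α v p → S.label (G.circle S.α p) = T.label (G.circle T.α p) :=
      forall_congr' fun p => by rw [H.passesBy_left_iff, H.passesBy_right_iff]
    rw [if_congr hpass' rfl rfl]
    by_cases h : ∀ p, ¬ PassesBy T.α v p → S.label (G.circle S.α p) = T.label (G.circle T.α p)
    · rw [if_pos h, if_congr (and_iff_right h) rfl rfl, if_congr (and_iff_right h) rfl rfl]
      unfold labelAt
      generalize S.label (G.circle S.α (Sum.inl (v, 0))) = a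
      generalize T.label (G.circle T.α (Sum.inl (v, 0))) = b
      generalize T.label (G.circle T.α (Sum.inl (v, 2))) = c
      rcases hδ with ⟨rfl, rfl⟩ | ⟨rfl, rfl⟩ <;> cases a <;> cases b <;> cases c <;> rfl
    · rw [if_neg h, if_neg fun h' => h h'.1, if_neg fun h' => h h'.1, add_zero]

end EnhancedState

/-! ### The Khovanov complex is a complex -/

lemma natCard_subtype_insert {X : Type*} [Finite X] {p q : X → Prop} {v : X} (hv : ¬ p v)
    (h : ∀ x, q x ↔ x = v ∨ p x) : Nat.card {x // q x} = Nat.card {x // p x} + 1 := by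
  have h1 : {x | q x} = insert v {x | p x} := by
    ext x
    simpa using h x
  have h2 : Set.ncard {x | q x} = Set.ncard {x | p x} + 1 := by
    rw [h1, Set.ncard_insert_of_notMem (show v ∉ {x | p x} from hv)]
  exact h2

namespace EnhancedState

variable {G : PlaneGraph} {D : LinkDiagram G}

open PlaneGraph MvPolynomial

instance : Fintype (EnhancedState D) := Fintype.ofFinite _

/-- The smoothings of `S` and `T` are the ends of an edge of the cube in the direction `v`. -/
structure IsEdge (v : G.Vertex) (S T : EnhancedState D) : Prop where
  isCrossing : D.IsCrossing v
  eq_false : S.α v = false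
  eq_update : T.α = Function.update S.α v true

open Classical in
/-- The contribution of the edges in the direction `v` to the coefficients of the differential. -/
def edgeCoeff (v : G.Vertex) (S T : EnhancedState D) : ℤ :=
  if IsEdge v S T then S.edgeSign v * localCoeff v S T else 0

lemma coeff_eq_sum_edgeCoeff (S T : EnhancedState D) : S.coeff T = ∑ v, edgeCoeff v S T := by
  classical
  refine Finset.sum_congr rfl fun v _ => ?_
  rw [edgeCoeff]
  refine if_congr ?_ rfl rfl
  exact ⟨fun h => ⟨h.1, h.2.1, h.2.2⟩, fun h => ⟨h.1, h.2, h.3⟩⟩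

lemma exists_of_coeff_ne_zero {S T : EnhancedState D} (h : S.coeff T ≠ 0) :
    ∃ v, IsEdge v S T ∧ localCoeff v S T ≠ 0 := by
  rw [coeff_eq_sum_edgeCoeff] at h
  obtain ⟨v, -, hv⟩ := Finset.exists_ne_zero_of_sum_ne_zero h
  unfold edgeCoeff at hv
  by_cases he : IsEdge v S T
  · rw [if_pos he] at hv
    exact ⟨v, he, right_ne_zero_of_mul hv⟩
  · exact absurd (if_neg he) hv

namespace IsEdge

variable {v : G.Vertex} {S T : EnhancedState D} (h : IsEdge v S T)
include h

lemma ne : S.α v ≠ T.α v := by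
  rw [h.eq_update, h.eq_false]; simp

lemma eq_of_ne (w : G.Vertex) (hw : w ≠ v) : S.α w = T.α w := by
  rw [h.eq_update, Function.update_of_ne hw]

lemma height_eq : T.height = S.height + 1 := by
  have := natCard_subtype_insert (p := fun v => D.IsCrossing v ∧ S.α v = true)
    (q := fun v => D.IsCrossing v ∧ T.α v = true) (v := v) (by simp [h.eq_false]) fun w => by
      by_cases hw : w = v
      · subst hw; simp [h.eq_update, h.isCrossing]
      · simp [h.eq_of_ne w hw, hw]
  unfold height
  rw [this]
  push_cast
  rfl

/-- The product and the coproduct of `V` have degree `-1`. -/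
lemma sum_deg_eq (h0 : localCoeff v S T ≠ 0) :
    ∑ C, (S.label C).deg = (∑ C, (T.label C).deg) + 1 := by
  classical
  have hlab : ∀ p : G.Piece, ¬ PassesBy S.α v p →
      S.label (G.circle S.α p) = T.label (G.circle T.α p) := by
    intro p hp
    by_contra hne
    refine h0 (if_neg fun h => hne (h p ?_ ?_))
    · exact fun h => hp (Or.inl h)
    · exact fun h => hp (Or.inr h)
  have hlc : localCoeff v S T = if G.circle S.α (Sum.inl (v, 0)) ≠ G.circle S.α (Sum.inl (v, 2))
      then Gen.mul (S.labelAt (Sum.inl (v, 0))) (S.labelAt (Sum.inl (v, 2)))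
        (T.labelAt (Sum.inl (v, 0)))
      else if G.circle T.α (Sum.inl (v, 0)) ≠ G.circle T.α (Sum.inl (v, 2)) then
        Gen.comul (S.labelAt (Sum.inl (v, 0))) (T.labelAt (Sum.inl (v, 0)))
          (T.labelAt (Sum.inl (v, 2)))
      else 0 := by
    rw [localCoeff]
    exact if_pos fun p hp hp' => hlab p fun h => h.elim hp hp'
  rw [hlc] at h0
  rcases merges_or_merges h.ne h.eq_of_ne with H | H
  · rw [if_pos H.ne] at h0
    have hsum := H.sum_add (fun C => (S.label C).deg) (fun C => (T.label C).deg)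
      fun p hp => by rw [hlab p hp]
    unfold labelAt at h0
    generalize S.label (G.circle S.α (Sum.inl (v, 0))) = a at *
    generalize S.label (G.circle S.α (Sum.inl (v, 2))) = b at *
    generalize T.label (G.circle T.α (Sum.inl (v, 0))) = c at *
    cases a <;> cases b <;> cases c <;> simp [Gen.mul, Gen.deg] at h0 hsum ⊢ <;> lia
  · rw [if_neg (not_not.2 H.eq), if_pos H.ne] at h0
    have hsum := H.sum_add (fun C => (T.label C).deg) (fun C => (S.label C).deg)
      fun p hp => by rw [hlab p (by rwa [H.passesBy_right_iff, ← H.passesBy_left_iff])]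
    unfold labelAt at h0
    generalize S.label (G.circle S.α (Sum.inl (v, 0))) = a at *
    generalize T.label (G.circle T.α (Sum.inl (v, 0))) = b at *
    generalize T.label (G.circle T.α (Sum.inl (v, 2))) = c at *
    cases a <;> cases b <;> cases c <;> simp [Gen.comul, Gen.deg] at h0 hsum ⊢ <;> lia

end IsEdge

lemma height_eq_of_coeff_ne_zero {S T : EnhancedState D} (h : S.coeff T ≠ 0) :
    T.height = S.height + 1 := by
  obtain ⟨v, hv, -⟩ := exists_of_coeff_ne_zero h
  exact hv.height_eq

lemma qdeg_eq_of_coeff_ne_zero {S T : EnhancedState D} (h : S.coeff T ≠ 0) :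
    T.qdeg = S.qdeg := by
  obtain ⟨v, hv, h0⟩ := exists_of_coeff_ne_zero h
  rw [qdeg, qdeg, hv.height_eq, hv.sum_deg_eq h0]
  ring

/-- The sign of the edge of the cube at the smoothing `α` in the direction `v`. -/
def cubeSign (D : LinkDiagram G) (α : G.Vertex → Bool) (v : G.Vertex) : ℤ :=
  (-1) ^ Nat.card {w : G.Vertex // w < v ∧ D.IsCrossing w ∧ α w = true}

lemma cubeSign_update {α : G.Vertex → Bool} {v : G.Vertex} (hc : D.IsCrossing v)
    (hv : α v = false) (w : G.Vertex) :
    cubeSign D (Function.update α v true) w = (if v < w then -1 else 1) * cubeSign D α w := by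
  unfold cubeSign
  split_ifs with h
  · rw [natCard_subtype_insert (p := fun x => x < w ∧ D.IsCrossing x ∧ α x = true) (v := v)
      (by simp [hv]), pow_succ']
    intro x
    by_cases hx : x = v
    · subst hx; simp [h, hc]
    · simp [hx]
  · rw [one_mul]
    congr 3
    ext x
    by_cases hx : x = v
    · subst hx; simp [h]
    · simp [hx]

/-- Each square of the cube contains an odd number of edges with sign `-1`. -/
lemma cubeSign_mul_cubeSign {α : G.Vertex → Bool} {v w : G.Vertex} (hvw : v ≠ w)
    (hcv : D.IsCrossing v) (hcw : D.IsCrossing w) (hv : α v = false) (hw : α w = false) :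
    cubeSign D α v * cubeSign D (Function.update α v true) w =
      -(cubeSign D α w * cubeSign D (Function.update α w true) v) := by
  rw [cubeSign_update hcv hv, cubeSign_update hcw hw]
  rcases lt_or_gt_of_ne hvw with h | h
  · rw [if_pos h, if_neg h.not_gt]; ring
  · rw [if_neg h.not_gt, if_pos h]; ring

/-- The sum over the states over the middle of a path of two edges, in terms of polynomials. -/
lemma sum_edgeCoeff_mul_edgeCoeff {v w : G.Vertex} {S U : EnhancedState D} (hvw : v ≠ w)
    (hcv : D.IsCrossing v) (hcw : D.IsCrossing w) (hv : S.α v = false) (hw : S.α w = false)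
    (hU : U.α = Function.update (Function.update S.α v true) w true) :
    ∑ T, edgeCoeff v S T * edgeCoeff w T U =
      cubeSign D S.α v * cubeSign D (Function.update S.α v true) w *
        labelCoeff U.label (labelMonomial S.label *
          (edgeFactor S.α v * edgeFactor (Function.update S.α v true) w)) := by
  set β := Function.update S.α v true with hβ
  have hcompat : ∀ u b, D.vertexType u = VertexType.smoothed b → β u = b := by
    intro u b hu
    have huv : u ≠ v := by
      rintro rfl
      rw [hcv] at hu
      cases hu
    rw [hβ, Function.update_of_ne huv]
    exact S.compat u b hu
  let st : (G.Circle β → Gen) → EnhancedState D := fun l => ⟨β, hcompat, l⟩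
  have hst : Function.Injective st := by
    intro l l' h
    simpa [st] using h
  have hedge (l) : IsEdge v S (st l) := ⟨hcv, hv, rfl⟩
  have hedge' (l) : IsEdge w (st l) U :=
    ⟨hcw, by change β w = false; rw [hβ, Function.update_of_ne hvw.symm, hw], hU⟩
  have hβU : ∀ u, u ≠ w → β u = U.α u := fun u hu => by rw [hU, Function.update_of_ne hu]
  have hβw : β w ≠ U.α w := by
    rw [hU, Function.update_self, hβ, Function.update_of_ne hvw.symm, hw]; decide
  have hterm (l) : edgeCoeff v S (st l) * edgeCoeff w (st l) U =
      cubeSign D S.α v * cubeSign D β w *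
        labelCoeff U.label (labelCoeff l (labelMonomial S.label * edgeFactor S.α v) •
          labelMonomial l * edgeFactor β w) := by
    rw [edgeCoeff, if_pos (hedge l), edgeCoeff, if_pos (hedge' l),
      localCoeff_eq_labelCoeff (hedge l).ne (hedge l).eq_of_ne,
      localCoeff_eq_labelCoeff (hedge' l).ne (hedge' l).eq_of_ne, smul_mul_assoc, map_smul,
      smul_eq_mul, show S.edgeSign v = cubeSign D S.α v from rfl,
      show (st l).edgeSign w = cubeSign D β w from rfl]
    ring
  rw [← Fintype.sum_of_injective st hst
    (fun l => edgeCoeff v S (st l) * edgeCoeff w (st l) U) _ _ fun _ => rfl]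
  · simp only [hterm]
    rw [← Finset.mul_sum, ← map_sum, ← Finset.sum_mul, ← mul_assoc]
    congr 1
    rw [eq_comm, ← sub_eq_zero, ← map_sub, ← sub_mul]
    exact labelCoeff_eq_zero_of_mem _
      (mul_edgeFactor_mem hβw hβU (sub_sum_labelCoeff_mem β _))
  · intro T hT
    rw [edgeCoeff, if_neg, zero_mul]
    intro h
    obtain ⟨α, hα, l⟩ := T
    obtain rfl : α = β := h.eq_update
    exact hT ⟨l, rfl⟩

lemma sum_edgeCoeff_mul_edgeCoeff_comm (v w : G.Vertex) (S U : EnhancedState D) :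
    ∑ T, edgeCoeff v S T * edgeCoeff w T U = -∑ T, edgeCoeff w S T * edgeCoeff v T U := by
  have hzero (v w : G.Vertex) (h : ¬ (v ≠ w ∧ D.IsCrossing v ∧ D.IsCrossing w ∧ S.α v = false ∧
      S.α w = false ∧ U.α = Function.update (Function.update S.α v true) w true)) :
      ∑ T, edgeCoeff v S T * edgeCoeff w T U = 0 := by
    refine Finset.sum_eq_zero fun T _ => ?_
    by_contra hne
    have h1 : IsEdge v S T := by
      by_contra h1
      rw [edgeCoeff, if_neg h1, zero_mul] at hne
      exact hne rfl
    have h2 : IsEdge w T U := by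
      by_contra h2
      rw [edgeCoeff.eq_def w, if_neg h2, mul_zero] at hne
      exact hne rfl
    have hvw : v ≠ w := by
      rintro rfl
      have := h2.eq_false
      rw [h1.eq_update] at this
      simp at this
    refine h ⟨hvw, h1.isCrossing, h2.isCrossing, h1.eq_false, ?_, ?_⟩
    · rw [h1.eq_of_ne w hvw.symm, h2.eq_false]
    · rw [h2.eq_update, h1.eq_update]
  by_cases h : v ≠ w ∧ D.IsCrossing v ∧ D.IsCrossing w ∧ S.α v = false ∧
      S.α w = false ∧ U.α = Function.update (Function.update S.α v true) w true
  · obtain ⟨hvw, hcv, hcw, hv, hw, hU⟩ := h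
    have hU' := hU.trans (Function.update_comm hvw true true S.α)
    rw [sum_edgeCoeff_mul_edgeCoeff hvw hcv hcw hv hw hU,
      sum_edgeCoeff_mul_edgeCoeff hvw.symm hcw hcv hw hv hU',
      cubeSign_mul_cubeSign hvw hcv hcw hv hw, neg_mul, neg_inj]
    congr 1
    rw [← sub_eq_zero, ← map_sub, ← mul_sub]
    refine labelCoeff_eq_zero_of_mem _ (Ideal.mul_mem_left _ _ ?_)
    rw [hU]
    exact edgeFactor_mul_sub_mem hvw hv hw
  · rw [hzero v w h, hzero w v, neg_zero]
    rintro ⟨hvw, hcv, hcw, hv, hw, hU⟩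
    exact h ⟨hvw.symm, hcw, hcv, hw, hv, hU.trans (Function.update_comm hvw true true S.α)⟩

lemma sum_coeff_mul_coeff (S U : EnhancedState D) : ∑ T, S.coeff T * T.coeff U = 0 := by
  have h : ∑ T, S.coeff T * T.coeff U =
      ∑ v, ∑ w, ∑ T, edgeCoeff v S T * edgeCoeff w T U := by
    simp only [coeff_eq_sum_edgeCoeff, Finset.sum_mul_sum]
    rw [Finset.sum_comm]
    refine Finset.sum_congr rfl fun v _ => Finset.sum_comm
  have h' : ∑ v, ∑ w, ∑ T, edgeCoeff v S T * edgeCoeff w T U =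
      -∑ v, ∑ w, ∑ T, edgeCoeff v S T * edgeCoeff w T U := by
    conv_lhs => rw [Finset.sum_comm]
    rw [← Finset.sum_neg_distrib]
    refine Finset.sum_congr rfl fun v _ => ?_
    rw [← Finset.sum_neg_distrib]
    exact Finset.sum_congr rfl fun w _ => sum_edgeCoeff_mul_edgeCoeff_comm w v S U
  lia

end EnhancedState

section Differential

variable (R : Type u) [CommRing R] {G : PlaneGraph} (D : LinkDiagram G)

lemma unnormalisedD_apply (j i i' : ℤ) (f : UnnormalisedKh R D i j) (T : StateIn D i' j) :
    unnormalisedD R D j i i' f T = ∑ S : StateIn D i j, ((S.1.coeff T.1 : ℤ) : R) * f S := rfl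

lemma unnormalisedD_unnormalisedD (j i i' i'' : ℤ) (f : UnnormalisedKh R D i j) :
    unnormalisedD R D j i' i'' (unnormalisedD R D j i i' f) = 0 := by
  funext U
  simp only [unnormalisedD_apply, Finset.mul_sum]
  rw [Finset.sum_comm]
  refine Finset.sum_eq_zero fun S _ => ?_
  have h : ∑ T : StateIn D i' j, S.1.coeff T.1 * T.1.coeff U.1 = 0 := by
    by_cases hi : i' = i + 1
    · rw [← EnhancedState.sum_coeff_mul_coeff S.1 U.1]
      refine Fintype.sum_of_injective Subtype.val Subtype.val_injective _ _ (fun T hT => ?_)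
        fun _ => rfl
      by_contra hne
      have h0 := left_ne_zero_of_mul hne
      refine hT ⟨⟨T, ?_, ?_⟩, rfl⟩
      · rw [EnhancedState.height_eq_of_coeff_ne_zero h0, S.2.1, hi]
      · rw [EnhancedState.qdeg_eq_of_coeff_ne_zero h0, S.2.2]
    · refine Finset.sum_eq_zero fun T _ => ?_
      by_contra hne
      have h0 := EnhancedState.height_eq_of_coeff_ne_zero (left_ne_zero_of_mul hne)
      rw [S.2.1, T.2.1] at h0
      exact hi h0
  have h' := congrArg (Int.cast : ℤ → R) h
  push_cast at h'
  simp only [← mul_assoc, ← Finset.sum_mul]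
  rw [show ∑ T : StateIn D i' j, ((T.1.coeff U.1 : ℤ) : R) * ((S.1.coeff T.1 : ℤ) : R) = 0 by
    rw [← h']
    exact Finset.sum_congr rfl fun T _ => mul_comm _ _, zero_mul]

end Differential

/-! ### Faces of the cube of smoothings -/

lemma natCard_subtype_or {X : Type*} [Finite X] {p q r : X → Prop} (hpq : ∀ x, p x → ¬ q x)
    (h : ∀ x, r x ↔ p x ∨ q x) :
    Nat.card {x // r x} = Nat.card {x // p x} + Nat.card {x // q x} := by
  have h1 : {x | r x} = {x | p x} ∪ {x | q x} := Set.ext h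
  have h2 : Set.ncard {x | r x} = Set.ncard {x | p x} + Set.ncard {x | q x} := by
    have h3 : Disjoint {x | p x} {x | q x} := Set.disjoint_left.2 hpq
    rw [h1, Set.ncard_union_eq h3]
  exact h2

namespace LinkDiagram

variable {G : PlaneGraph}

/-- `D'` arises from `D` by resolving some crossings. Its cube of smoothings is then a face
of the cube of `D`. -/
def IsFace (D D' : LinkDiagram G) : Prop :=
  ∀ v, D'.vertexType v = D.vertexType v ∨
    D.IsCrossing v ∧ ∃ b, D'.vertexType v = VertexType.smoothed b

/-- The crossing `v` of `D` is resolved to its `1`-smoothing in `D'`. -/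
def IsOneResolved (D D' : LinkDiagram G) (v : G.Vertex) : Prop :=
  D.IsCrossing v ∧ D'.vertexType v = VertexType.smoothed true

/-- The number of crossings of `D` that are resolved to the `1`-smoothing in `D'`. -/
def numOneResolved (D D' : LinkDiagram G) : ℤ := Nat.card {v // D.IsOneResolved D' v}

lemma IsOneResolved.not_isCrossing {D D' : LinkDiagram G} {v : G.Vertex}
    (h : D.IsOneResolved D' v) : ¬ D'.IsCrossing v := by
  intro h'
  have := h.2.symm.trans h'
  cases this

end LinkDiagram

open LinkDiagram

namespace LinkDiagram.IsFace

variable {G : PlaneGraph} {D D' : LinkDiagram G} (h : D.IsFace D')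
include h

lemma isCrossing {v : G.Vertex} (hv : D'.IsCrossing v) : D.IsCrossing v := by
  rcases h v with h' | h'
  · exact h'.symm.trans hv
  · exact h'.1

lemma isCrossing_and_iff (S : EnhancedState D') (v : G.Vertex) :
    D.IsCrossing v ∧ S.α v = true ↔ D'.IsCrossing v ∧ S.α v = true ∨ D.IsOneResolved D' v := by
  constructor
  · rintro ⟨hv, hS⟩
    rcases h v with h' | ⟨-, b, hb⟩
    · exact Or.inl ⟨h'.trans hv, hS⟩
    · refine Or.inr ⟨hv, ?_⟩
      rw [hb, ← S.compat v b hb, hS]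
  · rintro (⟨hv, hS⟩ | ⟨hv, hS⟩)
    · exact ⟨h.isCrossing hv, hS⟩
    · exact ⟨hv, S.compat v true hS⟩

/-- The states of `D'` are states of `D`. -/
def toState (S : EnhancedState D') : EnhancedState D where
  α := S.α
  compat v b hb := by
    refine S.compat v b ?_
    rcases h v with h' | h'
    · exact h'.trans hb
    · have := h'.1.symm.trans hb
      cases this
  label := S.label

lemma toState_injective : Function.Injective h.toState := by
  rintro ⟨α, hα, l⟩ ⟨α', hα', l'⟩ e
  cases e
  rfl

lemma mem_range_toState {S : EnhancedState D} :
    S ∈ Set.range h.toState ↔ ∀ v b, D'.vertexType v = VertexType.smoothed b → S.α v = b := by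
  constructor
  · rintro ⟨S, rfl⟩
    exact S.compat
  · exact fun hS => ⟨⟨S.α, hS, S.label⟩, rfl⟩

lemma height_toState (S : EnhancedState D') :
    (h.toState S).height = S.height + D.numOneResolved D' := by
  have := natCard_subtype_or (p := fun v => D'.IsCrossing v ∧ S.α v = true)
    (q := fun v => D.IsOneResolved D' v) (r := fun v => D.IsCrossing v ∧ S.α v = true)
    (fun v hv hv' => hv'.not_isCrossing hv.1) (h.isCrossing_and_iff S)
  exact (congrArg Nat.cast this).trans (Nat.cast_add _ _)

lemma qdeg_toState (S : EnhancedState D') :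
    (h.toState S).qdeg = S.qdeg + D.numOneResolved D' := by
  rw [EnhancedState.qdeg, EnhancedState.qdeg, height_toState, ← add_assoc]
  rfl

end LinkDiagram.IsFace

section FaceSign

variable {G : PlaneGraph} (D D' : LinkDiagram G)

/-- The quotient of the signs of an edge of the face in the direction `v` in the two cubes. -/
def edgeSignQuotient (v : G.Vertex) : ℤ :=
  (-1) ^ Nat.card {w : G.Vertex // w < v ∧ D.IsOneResolved D' w}

open Classical in
/-- The signs that identify the complex of the face `D'` with a part of the complex of `D`. -/
def faceSign (α : G.Vertex → Bool) : ℤ :=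
  ∏ v, if D'.IsCrossing v ∧ α v = true then edgeSignQuotient D D' v else 1

lemma edgeSignQuotient_mul_self (v : G.Vertex) :
    edgeSignQuotient D D' v * edgeSignQuotient D D' v = 1 := by
  rw [edgeSignQuotient, ← mul_pow]
  simp

lemma faceSign_mul_self (α : G.Vertex → Bool) : faceSign D D' α * faceSign D D' α = 1 := by
  rw [faceSign, ← Finset.prod_mul_distrib]
  refine Finset.prod_eq_one fun v _ => ?_
  split_ifs
  · exact edgeSignQuotient_mul_self D D' v
  · rfl

lemma cast_faceSign_mul_self (R : Type u) [CommRing R] (α : G.Vertex → Bool) :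
    (faceSign D D' α : R) * faceSign D D' α = 1 := by
  exact_mod_cast congrArg (Int.cast : ℤ → R) (faceSign_mul_self D D' α)

lemma faceSign_update {α : G.Vertex → Bool} {v : G.Vertex} (hc : D'.IsCrossing v)
    (hv : α v = false) :
    faceSign D D' (Function.update α v true) = edgeSignQuotient D D' v * faceSign D D' α := by
  classical
  unfold faceSign
  rw [← Finset.mul_prod_erase _ _ (Finset.mem_univ v),
    ← Finset.mul_prod_erase (a := v) _ _ (Finset.mem_univ v),
    if_pos ⟨hc, Function.update_self ..⟩, if_neg (by simp [hv]), one_mul]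
  congr 1
  refine Finset.prod_congr rfl fun w hw => ?_
  rw [Function.update_of_ne (Finset.ne_of_mem_erase hw)]

variable {D D'} (h : D.IsFace D')
include h

lemma LinkDiagram.IsFace.edgeSign_toState (S : EnhancedState D') (v : G.Vertex) :
    (h.toState S).edgeSign v = S.edgeSign v * edgeSignQuotient D D' v := by
  have := natCard_subtype_or (p := fun w => w < v ∧ D'.IsCrossing w ∧ S.α w = true)
    (q := fun w => w < v ∧ D.IsOneResolved D' w)
    (r := fun w => w < v ∧ D.IsCrossing w ∧ S.α w = true)
    (fun w hw hw' => hw'.2.not_isCrossing hw.2.1)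
    (fun w => by rw [h.isCrossing_and_iff S, and_or_left])
  rw [EnhancedState.edgeSign, EnhancedState.edgeSign, edgeSignQuotient, ← pow_add, ← this]
  rfl

lemma LinkDiagram.IsFace.isEdge_toState_iff {v : G.Vertex} {S T : EnhancedState D'} :
    EnhancedState.IsEdge v (h.toState S) (h.toState T) ↔ EnhancedState.IsEdge v S T := by
  constructor
  · intro he
    refine ⟨?_, he.2, he.3⟩
    rcases h v with h' | ⟨-, b, hb⟩
    · exact h'.trans he.1
    · exact absurd ((S.compat v b hb).trans (T.compat v b hb).symm) he.ne
  · exact fun he => ⟨h.isCrossing he.1, he.2, he.3⟩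

lemma LinkDiagram.IsFace.faceSign_mul_coeff (S T : EnhancedState D') :
    faceSign D D' T.α * (h.toState S).coeff (h.toState T) = S.coeff T * faceSign D D' S.α := by
  rw [EnhancedState.coeff_eq_sum_edgeCoeff, EnhancedState.coeff_eq_sum_edgeCoeff,
    Finset.mul_sum, Finset.sum_mul]
  refine Finset.sum_congr rfl fun v _ => ?_
  unfold EnhancedState.edgeCoeff
  by_cases he : EnhancedState.IsEdge v S T
  · rw [if_pos he, if_pos (h.isEdge_toState_iff.2 he), he.eq_update,
      faceSign_update D D' he.isCrossing he.eq_false, h.edgeSign_toState]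
    change edgeSignQuotient D D' v * faceSign D D' S.α *
      (S.edgeSign v * edgeSignQuotient D D' v * EnhancedState.localCoeff v S T) = _
    have := edgeSignQuotient_mul_self D D' v
    linear_combination faceSign D D' S.α * S.edgeSign v * EnhancedState.localCoeff v S T * this
  · rw [if_neg he, if_neg (h.isEdge_toState_iff.not.2 he), mul_zero, zero_mul]

end FaceSign

namespace LinkDiagram.IsFace

variable {G : PlaneGraph} {D D' : LinkDiagram G} (h : D.IsFace D') {i i' j j' : ℤ}
  (hi : i = i' + D.numOneResolved D') (hj : j = j' + D.numOneResolved D')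

/-- The states of `D'` of a given bidegree as states of `D`. -/
def toStateIn (S : StateIn D' i' j') : StateIn D i j :=
  ⟨h.toState S.1, by rw [height_toState, S.2.1, hi], by rw [qdeg_toState, S.2.2, hj]⟩

lemma toStateIn_injective : Function.Injective (h.toStateIn hi hj) :=
  fun _ _ e => Subtype.ext (h.toState_injective (congrArg Subtype.val e))

lemma mem_range_toStateIn {S : StateIn D i j} (hS : S.1 ∈ Set.range h.toState) :
    S ∈ Set.range (h.toStateIn hi hj) := by
  obtain ⟨S', hS'⟩ := hS
  refine ⟨⟨S', ?_, ?_⟩, Subtype.ext hS'⟩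
  · have := h.height_toState S'
    rw [hS', S.2.1] at this
    lia
  · have := h.qdeg_toState S'
    rw [hS', S.2.2] at this
    lia

variable (R : Type u) [CommRing R]

/-- The restriction, up to signs, of functions on the states of `D` to the states of `D'`. -/
def faceMap : UnnormalisedKh R D i j →ₗ[R] UnnormalisedKh R D' i' j' where
  toFun f S := (faceSign D D' S.1.α : R) * f (h.toStateIn hi hj S)
  map_add' _ _ := funext fun _ => mul_add _ _ _
  map_smul' _ _ := funext fun _ => mul_left_comm _ _ _

lemma faceMap_apply (f : UnnormalisedKh R D i j) (S : StateIn D' i' j') :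
    h.faceMap hi hj R f S = (faceSign D D' S.1.α : R) * f (h.toStateIn hi hj S) := rfl

lemma faceMap_eq_zero_iff {f : UnnormalisedKh R D i j} :
    h.faceMap hi hj R f = 0 ↔ ∀ S, f (h.toStateIn hi hj S) = 0 := by
  constructor
  · intro hf S
    have h1 := congrFun hf S
    rw [faceMap_apply] at h1
    rw [← one_mul (f _), ← cast_faceSign_mul_self D D' R S.1.α, mul_assoc, h1]
    exact mul_zero _
  · intro hf
    funext S
    rw [faceMap_apply, hf, mul_zero]
    rfl

lemma exists_faceMap_eq (g : UnnormalisedKh R D' i' j') :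
    ∃ f : UnnormalisedKh R D i j, h.faceMap hi hj R f = g ∧
      ∀ S, f S ≠ 0 → S.1 ∈ Set.range h.toState := by
  classical
  have hinj := h.toStateIn_injective hi hj
  refine ⟨Function.extend (h.toStateIn hi hj) (fun S => (faceSign D D' S.1.α : R) * g S) 0,
    funext fun S => ?_, fun S hS => ?_⟩
  · rw [faceMap_apply, hinj.extend_apply, ← mul_assoc, cast_faceSign_mul_self, one_mul]
  · by_contra hn
    refine hS (Function.extend_apply' _ _ _ ?_)
    rintro ⟨S', rfl⟩
    exact hn ⟨S'.1, rfl⟩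

/-- The restriction to `D'` commutes with the differentials on functions with
the property that the differential has no contributions from outside `D'`. -/
lemma faceMap_unnormalisedD {i₂ i₂' : ℤ} (hi₂ : i₂ = i₂' + D.numOneResolved D')
    (f : UnnormalisedKh R D i j)
    (hf : ∀ S, f S ≠ 0 → ∀ T, S.1.coeff (h.toState T) ≠ 0 → S.1 ∈ Set.range h.toState) :
    h.faceMap hi₂ hj R (unnormalisedD R D j i i₂ f) =
      unnormalisedD R D' j' i' i₂' (h.faceMap hi hj R f) := by
  funext T
  rw [faceMap_apply, unnormalisedD_apply, unnormalisedD_apply, Finset.mul_sum]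
  symm
  refine Fintype.sum_of_injective _ (h.toStateIn_injective hi hj) _ _ (fun S hS => ?_)
    fun S => ?_
  · by_contra hne
    have h1 := right_ne_zero_of_mul hne
    have h2 := left_ne_zero_of_mul h1
    refine hS (h.mem_range_toStateIn hi hj (hf S (right_ne_zero_of_mul h1) T.1 ?_))
    intro h3
    exact h2 (by rw [toStateIn, h3, Int.cast_zero])
  · have := congrArg (Int.cast : ℤ → R) (h.faceSign_mul_coeff S.1 T.1)
    push_cast at this
    rw [faceMap_apply, ← mul_assoc, ← mul_assoc, ← this]
    rfl

end LinkDiagram.IsFace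

/-! ### Successive resolution of the chosen crossings -/

namespace LinkDiagram

variable {G : PlaneGraph} {m : ℕ} {D : LinkDiagram G} {c : Fin m → G.Vertex}

lemma card_crossings (o : D.Orientation) :
    (Nat.card {v // D.IsCrossing v} : ℤ) = o.nPos + o.nNeg := by
  have := natCard_subtype_or (p := o.IsPositive) (q := o.IsNegative) (r := D.IsCrossing)
    (fun v hp hn => hn.2 hp.2) fun v => by
      unfold Orientation.IsPositive Orientation.IsNegative
      tauto
  exact (congrArg Nat.cast this).trans (Nat.cast_add _ _)

lemma oneResolved_of_exists {k : ℕ} {v : G.Vertex} (h : ∃ i : Fin m, (i : ℕ) < k ∧ c i = v) :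
    (D.oneResolved c k).vertexType v = VertexType.smoothed true := if_pos h

lemma oneResolved_of_not_exists {k : ℕ} {v : G.Vertex}
    (h : ¬ ∃ i : Fin m, (i : ℕ) < k ∧ c i = v) :
    (D.oneResolved c k).vertexType v = D.vertexType v := if_neg h

lemma zeroResolved_self (i : Fin m) :
    (D.zeroResolved c i).vertexType (c i) = VertexType.smoothed false := Function.update_self ..

lemma zeroResolved_of_ne {i : Fin m} {v : G.Vertex} (h : v ≠ c i) :
    (D.zeroResolved c i).vertexType v = (D.oneResolved c i).vertexType v :=
  Function.update_of_ne h ..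

lemma isCrossing_oneResolved_iff {k : ℕ} {v : G.Vertex} :
    (D.oneResolved c k).IsCrossing v ↔
      D.IsCrossing v ∧ ¬ ∃ i : Fin m, (i : ℕ) < k ∧ c i = v := by
  by_cases h : ∃ i : Fin m, (i : ℕ) < k ∧ c i = v
  · rw [IsCrossing, oneResolved_of_exists h]
    simp [h]
  · rw [IsCrossing, oneResolved_of_not_exists h]
    simp [h, IsCrossing]

lemma isCrossing_zeroResolved_iff {i : Fin m} {v : G.Vertex} :
    (D.zeroResolved c i).IsCrossing v ↔ (D.oneResolved c i).IsCrossing v ∧ v ≠ c i := by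
  by_cases h : v = c i
  · subst h
    rw [IsCrossing, zeroResolved_self]
    simp
  · rw [IsCrossing, zeroResolved_of_ne h]
    simp [h, IsCrossing]

lemma exists_lt_succ_iff (k : Fin m) (v : G.Vertex) :
    (∃ i : Fin m, (i : ℕ) < k + 1 ∧ c i = v) ↔
      v = c k ∨ ∃ i : Fin m, (i : ℕ) < k ∧ c i = v := by
  constructor
  · rintro ⟨i, hi, rfl⟩
    rcases Nat.lt_succ_iff_lt_or_eq.1 hi with h | h
    · exact Or.inr ⟨i, h, rfl⟩
    · exact Or.inl (congrArg c (Fin.ext h))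
  · rintro (rfl | ⟨i, hi, rfl⟩)
    · exact ⟨k, Nat.lt_succ_self _, rfl⟩
    · exact ⟨i, Nat.lt_succ_of_lt hi, rfl⟩

lemma not_exists_lt_self (hc : Function.Injective c) (k : Fin m) :
    ¬ ∃ i : Fin m, (i : ℕ) < k ∧ c i = c k := by
  rintro ⟨i, hi, h⟩
  rw [hc h] at hi
  exact lt_irrefl _ hi

lemma isCrossing_oneResolved_succ_iff (k : Fin m) (v : G.Vertex) :
    (D.oneResolved c (k + 1)).IsCrossing v ↔ (D.oneResolved c k).IsCrossing v ∧ v ≠ c k := by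
  rw [isCrossing_oneResolved_iff, isCrossing_oneResolved_iff, exists_lt_succ_iff]
  generalize (∃ i : Fin m, (i : ℕ) < k ∧ c i = v) = p
  tauto

lemma card_exists_lt (hc : Function.Injective c) {k : ℕ} (hk : k ≤ m) :
    Nat.card {v // ∃ i : Fin m, (i : ℕ) < k ∧ c i = v} = k := by
  induction k with
  | zero => simp
  | succ k ih =>
    rw [natCard_subtype_insert (p := fun v => ∃ i : Fin m, (i : ℕ) < k ∧ c i = v)
      (not_exists_lt_self hc ⟨k, hk⟩) (exists_lt_succ_iff ⟨k, hk⟩), ih (by lia)]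

lemma isCrossing_oneResolved_self
    (hc : Function.Injective c) (hD : ∀ i, D.IsCrossing (c i)) (k : Fin m) :
    (D.oneResolved c k).IsCrossing (c k) :=
  isCrossing_oneResolved_iff.2 ⟨hD k, not_exists_lt_self hc k⟩

lemma isFace_oneResolved (hD : ∀ i, D.IsCrossing (c i)) (k : ℕ) : D.IsFace (D.oneResolved c k) := by
  intro v
  by_cases h : ∃ i : Fin m, (i : ℕ) < k ∧ c i = v
  · obtain ⟨i, -, rfl⟩ := id h
    exact Or.inr ⟨hD i, true, oneResolved_of_exists h⟩
  · exact Or.inl (oneResolved_of_not_exists h)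

lemma isFace_zeroResolved (hD : ∀ i, D.IsCrossing (c i)) (k : Fin m) :
    D.IsFace (D.zeroResolved c k) := by
  intro v
  by_cases h : v = c k
  · subst h
    exact Or.inr ⟨hD k, false, zeroResolved_self k⟩
  · rw [zeroResolved_of_ne h]
    exact isFace_oneResolved hD k v

lemma isOneResolved_oneResolved_iff (hD : ∀ i, D.IsCrossing (c i)) {k : ℕ} {v : G.Vertex} :
    D.IsOneResolved (D.oneResolved c k) v ↔ ∃ i : Fin m, (i : ℕ) < k ∧ c i = v := by
  constructor
  · rintro ⟨hv, h⟩
    by_contra hn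
    rw [oneResolved_of_not_exists hn, hv] at h
    cases h
  · intro h
    obtain ⟨i, -, rfl⟩ := id h
    exact ⟨hD i, oneResolved_of_exists h⟩

lemma numOneResolved_oneResolved
    (hc : Function.Injective c) (hD : ∀ i, D.IsCrossing (c i)) {k : ℕ} (hk : k ≤ m) :
    D.numOneResolved (D.oneResolved c k) = k := by
  simp only [numOneResolved, isOneResolved_oneResolved_iff hD, card_exists_lt hc hk]

lemma numOneResolved_zeroResolved
    (hc : Function.Injective c) (hD : ∀ i, D.IsCrossing (c i)) (k : Fin m) :
    D.numOneResolved (D.zeroResolved c k) = k := by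
  rw [← numOneResolved_oneResolved hc hD k.2.le, numOneResolved, numOneResolved]
  congr 3
  ext v
  by_cases h : v = c k
  · subst h
    refine iff_of_false (fun h => ?_) fun h => ?_
    · have := h.2
      rw [zeroResolved_self] at this
      cases this
    · exact not_exists_lt_self hc k ((isOneResolved_oneResolved_iff hD).1 h)
  · rw [IsOneResolved, zeroResolved_of_ne h, IsOneResolved]

lemma card_crossings_oneResolved
    (hc : Function.Injective c) (hD : ∀ i, D.IsCrossing (c i)) {k : ℕ} (hk : k ≤ m) :
    (Nat.card {v // D.IsCrossing v} : ℤ) =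
      Nat.card {v // (D.oneResolved c k).IsCrossing v} + k := by
  have := natCard_subtype_or (p := (D.oneResolved c k).IsCrossing)
    (q := fun v => ∃ i : Fin m, (i : ℕ) < k ∧ c i = v) (r := D.IsCrossing)
    (fun v hv hv' => (isCrossing_oneResolved_iff.1 hv).2 hv') (fun v => by
      rw [isCrossing_oneResolved_iff]
      constructor
      · tauto
      · rintro (h | ⟨i, -, rfl⟩)
        exacts [h.1, hD i])
  rw [card_exists_lt hc hk] at this
  exact_mod_cast this

lemma card_crossings_zeroResolved
    (hc : Function.Injective c) (hD : ∀ i, D.IsCrossing (c i)) (k : Fin m) :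
    (Nat.card {v // (D.oneResolved c k).IsCrossing v} : ℤ) =
      Nat.card {v // (D.zeroResolved c k).IsCrossing v} + 1 := by
  have := natCard_subtype_insert (p := (D.zeroResolved c k).IsCrossing)
    (q := (D.oneResolved c k).IsCrossing) (v := c k)
    (fun h => (isCrossing_zeroResolved_iff.1 h).2 rfl) (fun v => by
      rw [isCrossing_zeroResolved_iff]
      have := isCrossing_oneResolved_self hc hD k
      by_cases h : v = c k
      · subst h; tauto
      · tauto)
  exact_mod_cast this

namespace ResolvedOrientations

variable {o : D.Orientation} (O : D.ResolvedOrientations o c)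

lemma nNeg_one_zero : (O.one 0).nNeg = o.nNeg := by
  unfold Orientation.nNeg
  congr 3
  ext v
  rw [Orientation.IsNegative, Orientation.IsNegative, O.one_zero, isCrossing_oneResolved_iff]
  simp

/-- If the crossing is negative, it is the only negative crossing that `D^{k+1}` loses. -/
lemma a_eq
    (hc : Function.Injective c) (hD : ∀ i, D.IsCrossing (c i)) (k : Fin m) :
    O.a k = (O.one k).nNeg - (O.one (k + 1)).nNeg - 1 := by
  unfold a
  split_ifs with h
  · rfl
  · have hneg : (O.one k).IsNegative (c k) :=
      ⟨isCrossing_oneResolved_self hc hD k, fun h' =>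
        h ⟨isCrossing_oneResolved_self hc hD k, h'⟩⟩
    have := natCard_subtype_insert (p := (O.one (k + 1)).IsNegative)
      (q := (O.one k).IsNegative) (v := c k)
      (fun h => ((isCrossing_oneResolved_succ_iff k _).1 h.1).2 rfl) fun v => by
        by_cases hv : v = c k
        · subst hv
          simp [hneg]
        · simp only [Orientation.IsNegative, isCrossing_oneResolved_succ_iff,
            O.of_negative k hneg, hv, ne_eq, not_false_eq_true, and_true, false_or]
    unfold Orientation.nNeg
    rw [this]
    push_cast
    ring

/-- If the crossing is positive, `D̃^{k+1}` loses no negative crossing. -/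
lemma aTilde_eq (k : Fin m) : O.aTilde k = (O.one k).nNeg - (O.zero k).nNeg := by
  unfold aTilde
  split_ifs with h
  · have : (O.one k).IsNegative = (O.zero k).IsNegative := by
      ext v
      by_cases hv : v = c k
      · subst hv
        exact iff_of_false (fun h' => h'.2 h.2)
          fun h' => (isCrossing_zeroResolved_iff.1 h'.1).2 rfl
      · simp only [Orientation.IsNegative, isCrossing_zeroResolved_iff, O.of_positive k h,
          ne_eq, hv, not_false_eq_true, and_true]
    unfold Orientation.nNeg
    rw [this, sub_self]
  · rfl

lemma filter_lt_succ (k : Fin m) :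
    (Finset.univ.filter fun i : Fin m => i.val < k.val + 1) =
      insert k (Finset.univ.filter fun i : Fin m => i.val < k.val) := by
  ext i
  simp only [Finset.mem_filter, Finset.mem_univ, true_and, Finset.mem_insert, Fin.ext_iff]
  lia

lemma A_eq
    (hc : Function.Injective c) (hD : ∀ i, D.IsCrossing (c i)) {k : ℕ} (hk : k ≤ m) :
    O.A k = o.nNeg - (O.one k).nNeg - k := by
  induction k with
  | zero => simp [A, nNeg_one_zero]
  | succ k ih =>
    have h1 : O.A (k + 1) = O.a ⟨k, hk⟩ + O.A k := by
      unfold A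
      rw [filter_lt_succ ⟨k, hk⟩, Finset.sum_insert (by simp)]
    rw [h1, ih (by lia), O.a_eq hc hD]
    push_cast
    ring

lemma B_eq {k : ℕ} (hk : k ≤ m) : O.B k = 3 * O.A k + k := by
  induction k with
  | zero => simp [A, B]
  | succ k ih =>
    have h1 : O.A (k + 1) = O.a ⟨k, hk⟩ + O.A k := by
      unfold A
      rw [filter_lt_succ ⟨k, hk⟩, Finset.sum_insert (by simp)]
    have h2 : O.B (k + 1) = O.b ⟨k, hk⟩ + O.B k := by
      unfold B
      rw [filter_lt_succ ⟨k, hk⟩, Finset.sum_insert (by simp)]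
    rw [h1, h2, ih (by lia), b]
    push_cast
    ring

lemma degree_one
    (hc : Function.Injective c) (hD : ∀ i, D.IsCrossing (c i)) {k : ℕ} (hk : k ≤ m)
    {n n' : ℤ} (hn : n' = n + O.A k) :
    n + o.nNeg = n' + (O.one k).nNeg + D.numOneResolved (D.oneResolved c k) := by
  rw [numOneResolved_oneResolved hc hD hk, hn, O.A_eq hc hD hk]
  ring

lemma qdegree_one
    (hc : Function.Injective c) (hD : ∀ i, D.IsCrossing (c i)) {k : ℕ} (hk : k ≤ m) (j : ℤ) :
    j - (o.nPos - 2 * o.nNeg) = j + O.B k - ((O.one k).nPos - 2 * (O.one k).nNeg) +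
      D.numOneResolved (D.oneResolved c k) := by
  have h1 := card_crossings_oneResolved hc hD hk
  rw [card_crossings o, card_crossings (O.one k)] at h1
  rw [numOneResolved_oneResolved hc hD hk, O.B_eq hk, O.A_eq hc hD hk]
  linear_combination -h1

lemma degree_zero
    (hc : Function.Injective c) (hD : ∀ i, D.IsCrossing (c i)) (k : Fin m)
    {n n' : ℤ} (hn : n' = n + O.A k + O.aTilde k) :
    n + o.nNeg = n' + (O.zero k).nNeg + D.numOneResolved (D.zeroResolved c k) := by
  rw [numOneResolved_zeroResolved hc hD, hn, O.A_eq hc hD k.2.le, O.aTilde_eq]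
  ring

lemma qdegree_zero
    (hc : Function.Injective c) (hD : ∀ i, D.IsCrossing (c i)) (k : Fin m) (j : ℤ) :
    j - (o.nPos - 2 * o.nNeg) = j + O.B k + O.bTilde k -
      ((O.zero k).nPos - 2 * (O.zero k).nNeg) + D.numOneResolved (D.zeroResolved c k) := by
  have h1 := card_crossings_oneResolved hc hD k.2.le
  have h2 := card_crossings_zeroResolved hc hD k
  rw [card_crossings o, h2, card_crossings (O.zero k)] at h1
  rw [numOneResolved_zeroResolved hc hD, O.B_eq k.2.le, bTilde, O.A_eq hc hD k.2.le,
    O.aTilde_eq]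
  linear_combination -h1

end ResolvedOrientations

end LinkDiagram

/-! ### The filtration of the Khovanov complex -/

section Filtration

variable (R : Type u) [CommRing R] {G : PlaneGraph} {D : LinkDiagram G} (o : D.Orientation)
  {m : ℕ} (c : Fin m → G.Vertex) (j : ℤ)

lemma skeinFiltration_antitone (n : ℤ) : Antitone fun s => skeinFiltration R o c j s n :=
  fun _ _ hs _ hf S hS =>
    ⟨hs.trans (hf S hS).1, fun i hi => (hf S hS).2 i (hi.trans_le hs)⟩

lemma skeinFiltration_eq_top (n : ℤ) {s : ℤ} (hs : s ≤ 0) :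
    skeinFiltration R o c j s n = ⊤ := by
  refine eq_top_iff.2 fun f _ S _ => ⟨by lia, fun i hi => ?_⟩
  lia

lemma skeinFiltration_eq_bot (n : ℤ) {s : ℤ} (hs : (m : ℤ) < s) :
    skeinFiltration R o c j s n = ⊥ := by
  refine eq_bot_iff.2 fun f hf => funext fun S => ?_
  by_contra h
  exact hs.not_ge (hf S h).1

/-- The differential changes `0`-smoothings to `1`-smoothings only. -/
lemma eq_true_of_coeff_ne_zero {S T : EnhancedState D} (h : S.coeff T ≠ 0) {v : G.Vertex}
    (hv : S.α v = true) : T.α v = true := by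
  obtain ⟨w, hw, -⟩ := EnhancedState.exists_of_coeff_ne_zero h
  by_cases hvw : v = w
  · rw [hvw, hw.eq_update, Function.update_self]
  · rw [← hw.eq_of_ne v hvw, hv]

lemma khD_mem_skeinFiltration {s n n' : ℤ} {f : KhComplex R o j n}
    (hf : f ∈ skeinFiltration R o c j s n) :
    khD R o j n n' f ∈ skeinFiltration R o c j s n' := by
  intro T hT
  obtain ⟨S, -, hS⟩ := Finset.exists_ne_zero_of_sum_ne_zero
    ((unnormalisedD_apply R D _ _ _ f T).symm.trans_ne hT)
  have h1 := hf S (right_ne_zero_of_mul hS)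
  refine ⟨h1.1, fun i hi => eq_true_of_coeff_ne_zero (fun h => ?_) (h1.2 i hi)⟩
  refine left_ne_zero_of_mul hS ?_
  rw [h, Int.cast_zero]

lemma isFilteredComplex_skeinFiltration :
    IsFilteredComplex (khD R o j) (skeinFiltration R o c j) where
  d_d _ _ _ _ := unnormalisedD_unnormalisedD R D _ _ _ _ _
  d_mem _ _ _ _ hf := khD_mem_skeinFiltration R o c j hf
  anti n := skeinFiltration_antitone R o c j n

end Filtration

namespace LinkDiagram.ResolvedOrientations

variable {R : Type u} [CommRing R] {G : PlaneGraph} {m : ℕ} {D : LinkDiagram G}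
  {c : Fin m → G.Vertex} {o : D.Orientation} (O : D.ResolvedOrientations o c)
  (hc : Function.Injective c) (hD : ∀ i, D.IsCrossing (c i)) (j : ℤ)

lemma mem_range_toState_oneResolved {k : ℕ} {S : EnhancedState D} :
    S ∈ Set.range (isFace_oneResolved hD k).toState ↔
      ∀ i : Fin m, (i : ℕ) < k → S.α (c i) = true := by
  rw [IsFace.mem_range_toState]
  constructor
  · exact fun h i hi => h _ _ (oneResolved_of_exists ⟨i, hi, rfl⟩)
  · intro h v b hb
    by_cases hv : ∃ i : Fin m, (i : ℕ) < k ∧ c i = v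
    · obtain ⟨i, hi, rfl⟩ := id hv
      rw [oneResolved_of_exists hv] at hb
      cases hb
      exact h i hi
    · rw [oneResolved_of_not_exists hv] at hb
      exact S.compat v b hb

lemma mem_range_toState_zeroResolved {k : Fin m} {S : EnhancedState D} (hc : Function.Injective c) :
    S ∈ Set.range (isFace_zeroResolved hD k).toState ↔
      (∀ i : Fin m, (i : ℕ) < k → S.α (c i) = true) ∧ S.α (c k) = false := by
  rw [← mem_range_toState_oneResolved hD, IsFace.mem_range_toState, IsFace.mem_range_toState]
  constructor
  · intro h
    have h0 := h _ _ (zeroResolved_self k)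
    refine ⟨fun v b hb => ?_, h0⟩
    by_cases hv : v = c k
    · subst hv
      have := (isCrossing_oneResolved_self hc hD k).symm.trans hb
      cases this
    · exact h v b ((zeroResolved_of_ne hv).trans hb)
  · rintro ⟨h, h0⟩ v b hb
    by_cases hv : v = c k
    · subst hv
      rw [zeroResolved_self] at hb
      cases hb
      exact h0
    · exact h v b ((zeroResolved_of_ne hv).symm.trans hb)

section One

variable {k : ℕ} (hk : k ≤ m) {n n' : ℤ} (hn : n' = n + O.A k)

/-- The map from `F^k` to the complex of `D^k`. -/
def oneMap : skeinFiltration R o c j k n →ₗ[R] KhComplex R (O.one k) (j + O.B k) n' :=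
  ((isFace_oneResolved hD k).faceMap (O.degree_one hc hD hk hn) (O.qdegree_one hc hD hk j)
    R).comp (Submodule.subtype _)

lemma oneMap_bijective : Function.Bijective (O.oneMap (R := R) hc hD j hk hn) := by
  constructor
  · rw [← LinearMap.ker_eq_bot, LinearMap.ker_eq_bot']
    intro f hf
    refine Subtype.ext (funext fun S => ?_)
    by_contra h
    have hS := (f.2 S h).2
    obtain ⟨S', rfl⟩ := (isFace_oneResolved hD k).mem_range_toStateIn
      (O.degree_one hc hD hk hn) (O.qdegree_one hc hD hk j)
      ((mem_range_toState_oneResolved hD).2 fun i hi => hS i (by exact_mod_cast hi))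
    exact h ((IsFace.faceMap_eq_zero_iff _ _ _ R).1 hf S')
  · intro g
    obtain ⟨f, hf, hf'⟩ := (isFace_oneResolved hD k).exists_faceMap_eq
      (O.degree_one hc hD hk hn) (O.qdegree_one hc hD hk j) R g
    refine ⟨⟨f, fun S hS => ⟨by exact_mod_cast hk, fun i hi => ?_⟩⟩, hf⟩
    exact (mem_range_toState_oneResolved hD).1 (hf' S hS) i (by exact_mod_cast hi)

lemma oneMap_khD {n₂ n₂' : ℤ} (hn₂ : n₂' = n₂ + O.A k) (x : skeinFiltration R o c j k n)
    (y : skeinFiltration R o c j k n₂) (hy : y.1 = khD R o j n n₂ x.1) :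
    O.oneMap hc hD j hk hn₂ y =
      khD R (O.one k) (j + O.B k) n' n₂' (O.oneMap hc hD j hk hn x) := by
  refine (congrArg _ hy).trans (IsFace.faceMap_unnormalisedD _ _ _ R _ _ fun S hS _ _ => ?_)
  exact (mem_range_toState_oneResolved hD).2
    fun i hi => (x.2 S hS).2 i (by exact_mod_cast hi)

end One

section Zero

variable (k : Fin m) {n n' : ℤ} (hn : n' = n + O.A k + O.aTilde k)

/-- The map from `F^k` to the complex of the diagram `D̃^{k+1}`. -/
def zeroMap : skeinFiltration R o c j k n →ₗ[R]
    KhComplex R (O.zero k) (j + O.B k + O.bTilde k) n' :=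
  ((isFace_zeroResolved hD k).faceMap (O.degree_zero hc hD k hn) (O.qdegree_zero hc hD k j)
    R).comp (Submodule.subtype _)

lemma zeroMap_surjective : Function.Surjective (O.zeroMap (R := R) hc hD j k hn) := by
  intro g
  obtain ⟨f, hf, hf'⟩ := (isFace_zeroResolved hD k).exists_faceMap_eq
    (O.degree_zero hc hD k hn) (O.qdegree_zero hc hD k j) R g
  refine ⟨⟨f, fun S hS => ⟨by exact_mod_cast k.2.le, fun i hi => ?_⟩⟩, hf⟩
  exact ((mem_range_toState_zeroResolved hD hc).1 (hf' S hS)).1 i (by exact_mod_cast hi)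

lemma zeroMap_eq_zero_iff (x : skeinFiltration R o c j k n) :
    O.zeroMap hc hD j k hn x = 0 ↔ x.1 ∈ skeinFiltration R o c j (k + 1) n := by
  refine (IsFace.faceMap_eq_zero_iff _ _ _ R).trans ?_
  constructor
  · intro h S hS
    refine ⟨by have := k.2; lia, fun i hi => ?_⟩
    have hx := (x.2 S hS).2
    rcases (Int.lt_add_one_iff.1 hi).lt_or_eq with hi | hi
    · exact hx i hi
    · obtain rfl : i = k := Fin.ext (by exact_mod_cast hi)
      by_contra h0
      obtain ⟨S', rfl⟩ := (isFace_zeroResolved hD i).mem_range_toStateIn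
        (O.degree_zero hc hD i hn) (O.qdegree_zero hc hD i j)
        ((mem_range_toState_zeroResolved hD hc).2
          ⟨fun i hi => hx i (by exact_mod_cast hi), by simpa using h0⟩)
      exact hS (h S')
  · intro h S'
    by_contra hS
    have h1 := (h _ hS).2 k (by lia)
    have h2 := S'.1.compat _ _ (zeroResolved_self k)
    exact absurd (h1.symm.trans h2) (by decide)

lemma zeroMap_khD {n₂ n₂' : ℤ} (hn₂ : n₂' = n₂ + O.A k + O.aTilde k)
    (x : skeinFiltration R o c j k n) (y : skeinFiltration R o c j k n₂)
    (hy : y.1 = khD R o j n n₂ x.1) :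
    O.zeroMap hc hD j k hn₂ y =
      khD R (O.zero k) (j + O.B k + O.bTilde k) n' n₂' (O.zeroMap hc hD j k hn x) := by
  refine (congrArg _ hy).trans (IsFace.faceMap_unnormalisedD _ _ _ R _ _ fun S hS T hT => ?_)
  refine (mem_range_toState_zeroResolved hD hc).2
    ⟨fun i hi => (x.2 S hS).2 i (by exact_mod_cast hi), ?_⟩
  -- a contribution to a state with a `0`-smoothing comes from a state with a `0`-smoothing
  by_contra h0
  have h1 := eq_true_of_coeff_ne_zero hT (v := c k) (by simpa using h0)
  have h2 := T.compat _ _ (zeroResolved_self k)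
  exact absurd (h1.symm.trans h2) (by decide)

/-- The isomorphism from `F^k / F^{k+1}` to the complex of the diagram `D̃^{k+1}`. -/
def zeroEquiv : (skeinFiltration R o c j k n ⧸
    (skeinFiltration R o c j (k + 1) n).submoduleOf (skeinFiltration R o c j k n)) ≃ₗ[R]
      KhComplex R (O.zero k) (j + O.B k + O.bTilde k) n' :=
  (Submodule.quotEquivOfEq _ _ (Submodule.ext fun x =>
    (O.zeroMap_eq_zero_iff hc hD j k hn x).symm)).trans
      ((O.zeroMap hc hD j k hn).quotKerEquivOfSurjective (O.zeroMap_surjective hc hD j k hn))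

lemma zeroEquiv_mk (x : skeinFiltration R o c j k n) :
    O.zeroEquiv (R := R) hc hD j k hn (Submodule.Quotient.mk x) = O.zeroMap hc hD j k hn x := rfl

end Zero

end LinkDiagram.ResolvedOrientations

end

theorem mainTheorem3 (R : Type u) [CommRing R] {G : PlaneGraph} (D : LinkDiagram G)
    (o : D.Orientation) {m : ℕ} (c : Fin m → G.Vertex) (hc : Function.Injective c)
    (hD : ∀ i, D.IsCrossing (c i)) (O : D.ResolvedOrientations o c) (j : ℤ) :
    -- the Khovanov complex of `D` is a complex, and the filtration is a
    -- bounded decreasing filtration by subcomplexes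
    (∀ n, khD R o j (n + 1) (n + 2) ∘ₗ khD R o j n (n + 1) = 0) ∧
    (∀ n, Antitone fun s => skeinFiltration R o c j s n) ∧
    (∀ s n, skeinFiltration R o c j s n ≤
      (skeinFiltration R o c j s (n + 1)).comap (khD R o j n (n + 1))) ∧
    (∀ s n, s ≤ 0 → skeinFiltration R o c j s n = ⊤) ∧
    (∀ s n, (m : ℤ) < s → skeinFiltration R o c j s n = ⊥) ∧
    -- `F^k` is the shifted complex of `D^k`
    (∀ k : ℕ, k ≤ m →
      ∃ φ : ∀ n : ℤ, skeinFiltration R o c j k n ≃ₗ[R]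
          KhComplex R (O.one k) (j + O.B k) (n + O.A k),
        ∀ (n : ℤ) (x : skeinFiltration R o c j k n) (y : skeinFiltration R o c j k (n + 1)),
          y.1 = khD R o j n (n + 1) x.1 →
            φ (n + 1) y =
              khD R (O.one k) (j + O.B k) (n + O.A k) (n + 1 + O.A k) (φ n x)) ∧
    -- `F^k / F^{k+1}` is the shifted complex of the diagram in which
    -- the crossing `k + 1` is resolved to `0`
    (∀ k : Fin m,
      ∃ ψ : ∀ n : ℤ, (skeinFiltration R o c j k n ⧸
            (skeinFiltration R o c j (k + 1) n).submoduleOf (skeinFiltration R o c j k n)) ≃ₗ[R]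
          KhComplex R (O.zero k) (j + O.B k + O.bTilde k) (n + O.A k + O.aTilde k),
        ∀ (n : ℤ) (x : skeinFiltration R o c j k n) (y : skeinFiltration R o c j k (n + 1)),
          y.1 = khD R o j n (n + 1) x.1 →
            ψ (n + 1) (Submodule.Quotient.mk y) =
              khD R (O.zero k) (j + O.B k + O.bTilde k) (n + O.A k + O.aTilde k)
                (n + 1 + O.A k + O.aTilde k) (ψ n (Submodule.Quotient.mk x))) ∧
    -- the spectral sequence
    ∃ E : CohomologicalSpectralSequence (ModuleCat.{u} R) 1,
      Nonempty (FilteredComplexIso (khD R o j) (skeinFiltration R o c j) E) ∧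
      ConvergesTo E (fun n => Kh R o n j)
        (inducedFiltration (khD R o j) (skeinFiltration R o c j)) ∧
      (∀ (s : Fin m) (t : ℤ), Nonempty (((E.page 1 le_rfl).X ((s : ℤ), t) : Type u) ≃ₗ[R]
        Kh R (O.zero s) (s + t + O.A s + O.aTilde s) (j + O.B s + O.bTilde s))) ∧
      (∀ t : ℤ, Nonempty (((E.page 1 le_rfl).X ((m : ℤ), t) : Type u) ≃ₗ[R]
        Kh R (O.one m) (m + t + O.A m) (j + O.B m))) ∧
      (∀ s t : ℤ, s < 0 ∨ (m : ℤ) < s → Limits.IsZero ((E.page 1 le_rfl).X (s, t))) := by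
  have H := isFilteredComplex_skeinFiltration R o c j
  refine ⟨fun n => LinearMap.ext fun f => H.d_d _ _ _ f, H.anti,
    fun s n f hf => H.d_mem _ _ _ f hf, fun s n hs => skeinFiltration_eq_top R o c j n hs,
    fun s n hs => skeinFiltration_eq_bot R o c j n hs, fun k hk => ?_, fun k => ?_,
    H.spectralSequence, ⟨H.spectralSequenceIso⟩,
    H.convergesTo (fun s n hs => skeinFiltration_eq_top R o c j n hs)
      fun s n hs => skeinFiltration_eq_bot R o c j n hs, fun s t => ?_, fun t => ?_,
    fun s t hst => ?_⟩
  · exact ⟨fun n => LinearEquiv.ofBijective _ (O.oneMap_bijective hc hD j hk rfl),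
      fun n x y hy => O.oneMap_khD hc hD j hk rfl rfl x y hy⟩
  · refine ⟨fun n => O.zeroEquiv hc hD j k rfl, fun n x y hy => ?_⟩
    rw [O.zeroEquiv_mk, O.zeroEquiv_mk]
    exact O.zeroMap_khD hc hD j k rfl rfl x y hy
  · have h₀ : s + t + O.A s + O.aTilde s - 1 = s + t - 1 + O.A s + O.aTilde s := by ring
    have h₂ : s + t + O.A s + O.aTilde s + 1 = s + t + 1 + O.A s + O.aTilde s := by ring
    exact H.nonempty_firstPage_equiv (d' := khD R (O.zero s) (j + O.B s + O.bTilde s))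
      (O.zeroMap_surjective hc hD j s h₀) (O.zeroMap_surjective hc hD j s rfl)
      (O.zeroMap_eq_zero_iff hc hD j s rfl) (O.zeroMap_eq_zero_iff hc hD j s h₂)
      (O.zeroMap_khD hc hD j s h₀ rfl) (O.zeroMap_khD hc hD j s rfl h₂)
  · have h₀ : m + t + O.A m - 1 = m + t - 1 + O.A m := by ring
    have h₂ : m + t + O.A m + 1 = m + t + 1 + O.A m := by ring
    have hker {n n' : ℤ} (hn : n' = n + O.A m) (x : skeinFiltration R o c j m n) :
        O.oneMap hc hD j le_rfl hn x = 0 ↔ x.1 ∈ skeinFiltration R o c j (m + 1) n := by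
      rw [skeinFiltration_eq_bot R o c j n (lt_add_one (m : ℤ)), Submodule.mem_bot,
        Submodule.coe_eq_zero]
      exact map_eq_zero_iff _ (O.oneMap_bijective hc hD j le_rfl hn).1
    exact H.nonempty_firstPage_equiv (d' := khD R (O.one m) (j + O.B m))
      (O.oneMap_bijective hc hD j le_rfl h₀).2 (O.oneMap_bijective hc hD j le_rfl rfl).2
      (hker rfl) (hker h₂) (O.oneMap_khD hc hD j le_rfl h₀ rfl)
      (O.oneMap_khD hc hD j le_rfl rfl h₂)
  · have : Subsingleton (FilteredPage (khD R o j) (skeinFiltration R o c j) 1 s (s + t)) := by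
      rcases hst with hs | hs
      · exact IsFilteredComplex.subsingleton_page_of_eq_top
          (skeinFiltration_eq_top R o c j _ (by lia))
      · exact IsFilteredComplex.subsingleton_page_of_eq_bot
          (skeinFiltration_eq_bot R o c j _ hs)
    exact ModuleCat.isZero_of_subsingleton
      (ModuleCat.of R (FilteredPage (khD R o j) (skeinFiltration R o c j) 1 s (s + t)))
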